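/- \textbf{Setting.} Let $d\ge 1$, let $\delta\in(0,2)$ be known, and let $\Omega\subset\mathbb R^d$ be a non-empty bounded open set. Let $Y$ be a mean zero Gaussian process on $\mathbb R^d$ with $\operatorname{cov}(Y(s),Y(t))=\sigma^2 e^{-|\alpha M(s-t)|^\delta}$, where $\sigma,\alpha>0$ and $M$ is an upper triangular $d\times d$ matrix with positive diagonal and determinant $1$ ($\sigma,\alpha,M$ unknown; $|\cdot|$ is the Euclidean norm). \textbf{Estimators.} Put $\Omega_n=\Omega\cap(\mathbb Z^d/n)$, $\Delta_uY(t)=Y(t+u)-Y(t)$, and for a positive integer $m$, a vector $h\in\mathbb R^d$ and $s>0$ $$Q_n^m(h)=\frac1{\#\Omega_n}\sum_{j\in\Omega_n}n^\delta\bigl(\Delta_{h/n}^mY(j)\bigr)^2,\qquad D_{m,s}=\sum_{i,j=0}^m(-1)^{i+j}\binom mi\binom mj|i-j|^s .$$ Let $T=\sigma^{2/\delta}\alpha M$, so that $|Th|^\delta=\sigma^2\alpha^\delta|Mh|^\delta$. For a given $p$, estimate $|Th|^2$ by $\widehat{|Th|^2}=\bigl(-Q_n^p(h)/D_{p,\delta}\bigr)^{2/\delta}$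 for $h=e_k$ and $h=e_k-e_i$ $(i<k)$, and put $\hat G_{kk}=\widehat{|Te_k|^2}$, $\hat G_{ik}=\tfrac12\bigl(\widehat{|Te_i|^2}+\widehat{|Te_k|^2}-\widehat{|T(e_k-e_i)|^2}\bigr)$ for $i<k$. Let $\hat T$ be the upper triangular matrix built column by column from $\hat G$: if $R$ is the block of the first $k$ rows and columns of $\hat T$, the column $k+1$ of $\hat T$ is $\bigl(v,\sqrt{\hat G_{k+1,k+1}-|v|^2},0,\dots,0\bigr)^{\mathsf T}$ with $v=(R^{\mathsf T})^{-1}(\hat G_{i,k+1})_{i\le k}$. Put $$\widehat M=(\det\hat T)^{-1/d}\,\hat T,\qquad \widehat{\sigma^2\alpha^\delta}=(\det\hat T)^{\delta/d}.$$ For integers $q>p$ and a fixed $h\neq0$ put $$\widehat{\sigma^2\alpha^{2\delta}}=\frac{1}{|\widehat Mh|^{2\delta}}\cdot 2n^\delta\,\frac{Q_n^p(h)-\frac{D_{p,\delta}}{D_{q,\delta}}Q_n^q(h)}{D_{p,2\delta}-\frac{D_{p,\delta}}{D_{q,\delta}}D_{q,2\delta}},\qquad \hat\sigma=\left(\frac{\bigl(\widehat{\sigma^2\alpha^\delta}\bigr)^2}{\widehat{\sigma^2\alpha^{2\delta}}}\right)^{1/2},\qquad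 \hat\alpha=\left(\frac{\widehat{\sigma^2\alpha^{2\delta}}}{\widehat{\sigma^2\alpha^\delta}}\right)^{1/\delta}.$$ (Outside the event on which these expressions make sense, which fails only for finitely many $n$ almost surely, the values are arbitrary conventions.) \textbf{Theorem.} (i) For every integer $p\ge1$ one has $D_{p,\delta}\ne0$, and $\widehat{\sigma^2\alpha^\delta}\to\sigma^2\alpha^\delta$ and $\widehat M\to M$ with probability one as $n\to\infty$. (ii) If $2\delta<d$ and $\delta\neq1$, then for every integer $p>3\delta/2$ there is an integer $q>p$, not depending on $\sigma,\alpha,M$, on the process $Y$ or on the direction $h$, such that $D_{p,2\delta}-\frac{D_{p,\delta}}{D_{q,\delta}}D_{q,2\delta}\ne0$ and, for every fixed $h\in\mathbb R^d\setminus\{0\}$, $\hat\sigma\to\sigma$ and $\hat\alpha\to\alpha$ with probability one as $n\to\infty$. -/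

import Mathlib

open MeasureTheory ProbabilityTheory Filter Topology

noncomputable section

namespace IncrementEstimation

/-- `Y` is a mean zero Gaussian process on `ℝᵈ` (over the probability space `(S, P)`) with
autocovariance function `t ↦ σ² exp (-|α M t|^δ)`, where `|·|` is the Euclidean norm. -/
structure IsExpField {d : ℕ} {S : Type*} [MeasurableSpace S] (P : Measure S)
    (Y : EuclideanSpace ℝ (Fin d) → S → ℝ) (δ σ α : ℝ) (M : Matrix (Fin d) (Fin d) ℝ) : Prop where
  gaussian : IsGaussianProcess Y P
  mean_zero : ∀ t, ∫ ω, Y t ω ∂P = 0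
  cov_eq : ∀ s t, cov[Y s, Y t; P] =
    σ ^ 2 * Real.exp (-(‖α • Matrix.toEuclideanLin M (s - t)‖ ^ δ))

/-- Upper triangular matrices with positive diagonal and determinant one. -/
structure IsAnisotropy {d : ℕ} (M : Matrix (Fin d) (Fin d) ℝ) : Prop where
  upper : ∀ i j, j < i → M i j = 0
  diag_pos : ∀ i, 0 < M i i
  det_eq_one : M.det = 1

/-- The grid `Ωₙ = Ω ∩ (ℤᵈ / n)`. It is finite when `Ω` is bounded and `1 ≤ n`. -/
def grid {d : ℕ} (Ω : Set (EuclideanSpace ℝ (Fin d))) (n : ℕ) : Set (EuclideanSpace ℝ (Fin d)) :=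
  {t | t ∈ Ω ∧ ∃ z : Fin d → ℤ, ∀ i, t i = (z i : ℝ) / n}

/-- The averaged squared increments of order `m` in the direction `h`, normalised by `n ^ δ`:
`Qₙᵐ = (#Ωₙ)⁻¹ ∑_{j ∈ Ωₙ} n ^ δ (Δ_{h/n}ᵐ y (j))²`, where `Δ_u y (t) = y (t + u) - y (t)`.
Here `y` is a realisation of the field. -/
def Q {d : ℕ} (Ω : Set (EuclideanSpace ℝ (Fin d))) (δ : ℝ) (m : ℕ)
    (h : EuclideanSpace ℝ (Fin d)) (n : ℕ) (y : EuclideanSpace ℝ (Fin d) → ℝ) : ℝ :=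
  ((grid Ω n).ncard : ℝ)⁻¹ *
    ∑ᶠ j ∈ grid Ω n, (n : ℝ) ^ δ * ((fwdDiff ((n : ℝ)⁻¹ • h))^[m] y j) ^ 2

/-- The constants `D_{m,s} = ∑_{i,j=0}^m (-1)^{i+j} (m choose i) (m choose j) |i - j|^s`. -/
def D (m : ℕ) (s : ℝ) : ℝ :=
  ∑ i ∈ Finset.range (m + 1), ∑ j ∈ Finset.range (m + 1),
    (-1 : ℝ) ^ (i + j) * (m.choose i : ℝ) * (m.choose j : ℝ) * |(i : ℝ) - (j : ℝ)| ^ s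

/-- The constant `D_{p,2δ} - (D_{p,δ} / D_{q,δ}) D_{q,2δ}`. -/
def contrast (p q : ℕ) (δ : ℝ) : ℝ :=
  D p (2 * δ) - D p δ / D q δ * D q (2 * δ)

/-- The estimator `-Qₙᵖ / D_{p,δ}` of `σ² α^δ |M h|^δ`. -/
def firstEst {d : ℕ} (Ω : Set (EuclideanSpace ℝ (Fin d))) (δ : ℝ) (p : ℕ)
    (h : EuclideanSpace ℝ (Fin d)) (n : ℕ) (y : EuclideanSpace ℝ (Fin d) → ℝ) : ℝ :=
  -Q Ω δ p h n y / D p δ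

/-- The estimator `2 n^δ (Qₙᵖ - (D_{p,δ} / D_{q,δ}) Qₙ^q) / contrast p q δ` of
`σ² α^{2δ} |M h|^{2δ}`. -/
def secondEst {d : ℕ} (Ω : Set (EuclideanSpace ℝ (Fin d))) (δ : ℝ) (p q : ℕ)
    (h : EuclideanSpace ℝ (Fin d)) (n : ℕ) (y : EuclideanSpace ℝ (Fin d) → ℝ) : ℝ :=
  2 * (n : ℝ) ^ δ * (Q Ω δ p h n y - D p δ / D q δ * Q Ω δ q h n y) / contrast p q δ

/-- The estimator of `|T h|²`, where `T = σ^{2/δ} α M`, so that `|T h|^δ = σ² α^δ |M h|^δ`. -/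
def normSqEst {d : ℕ} (Ω : Set (EuclideanSpace ℝ (Fin d))) (δ : ℝ) (p : ℕ)
    (h : EuclideanSpace ℝ (Fin d)) (n : ℕ) (y : EuclideanSpace ℝ (Fin d) → ℝ) : ℝ :=
  firstEst Ω δ p h n y ^ (2 / δ)

/-- The estimator of the inner products `⟨T eᵢ, T eⱼ⟩` of the columns of `T = σ^{2/δ} α M`, by
polarisation from the directions `eⱼ` and `eⱼ - eᵢ` (only the entries `i ≤ j` are used below). -/
def gramEst {d : ℕ} (Ω : Set (EuclideanSpace ℝ (Fin d))) (δ : ℝ) (p n : ℕ)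
    (y : EuclideanSpace ℝ (Fin d) → ℝ) : Matrix (Fin d) (Fin d) ℝ :=
  Matrix.of fun i j =>
    if i = j then normSqEst Ω δ p (EuclideanSpace.single j 1) n y
    else (normSqEst Ω δ p (EuclideanSpace.single i 1) n y
        + normSqEst Ω δ p (EuclideanSpace.single j 1) n y
        - normSqEst Ω δ p (EuclideanSpace.single j 1 - EuclideanSpace.single i 1) n y) / 2

/-- Recovery of an upper triangular matrix `T` with positive diagonal from the inner products
`G i j = ⟨T eᵢ, T eⱼ⟩` of its columns, one column at a time: if `R` is the block formed by the
first `k` rows and columns, then the next column is `(v, √(G_{k+1,k+1} - |v|²), 0, …, 0)`, where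
`v` solves `Rᵀ v = (G_{i,k+1})_{i ≤ k}`. -/
def triangularFactor : (k : ℕ) → Matrix (Fin k) (Fin k) ℝ → Matrix (Fin k) (Fin k) ℝ
  | 0, _ => 0
  | k + 1, G =>
    let R : Matrix (Fin k) (Fin k) ℝ :=
      triangularFactor k (G.submatrix Fin.castSucc Fin.castSucc)
    let v : Fin k → ℝ := Matrix.mulVec (R.transpose)⁻¹ fun i => G i.castSucc (Fin.last k)
    let r : ℝ := Real.sqrt (G (Fin.last k) (Fin.last k) - ∑ i, v i ^ 2)
    Matrix.of (Fin.snoc (α := fun _ => Fin (k + 1) → ℝ)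
      (fun i => Fin.snoc (α := fun _ => ℝ) (R i) (v i))
      (Fin.snoc (α := fun _ => ℝ) (fun _ => 0) r))

/-- The estimator of `T = σ^{2/δ} α M`. -/
def scaledEst {d : ℕ} (Ω : Set (EuclideanSpace ℝ (Fin d))) (δ : ℝ) (p n : ℕ)
    (y : EuclideanSpace ℝ (Fin d) → ℝ) : Matrix (Fin d) (Fin d) ℝ :=
  triangularFactor d (gramEst Ω δ p n y)

/-- The estimator of `M = (det T)^{-1/d} T`. -/
def anisotropyEst {d : ℕ} (Ω : Set (EuclideanSpace ℝ (Fin d))) (δ : ℝ) (p n : ℕ)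
    (y : EuclideanSpace ℝ (Fin d) → ℝ) : Matrix (Fin d) (Fin d) ℝ :=
  (scaledEst Ω δ p n y).det ^ (-(1 / (d : ℝ))) • scaledEst Ω δ p n y

/-- The estimator of `σ² α^δ = (det T)^{δ/d}`. -/
def microergodicEst {d : ℕ} (Ω : Set (EuclideanSpace ℝ (Fin d))) (δ : ℝ) (p n : ℕ)
    (y : EuclideanSpace ℝ (Fin d) → ℝ) : ℝ :=
  (scaledEst Ω δ p n y).det ^ (δ / (d : ℝ))

/-- The estimator of `σ² α^{2δ}`, from the estimators of `σ² α^{2δ} |M h|^{2δ}` and of `M`. -/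
def secondCoeffEst {d : ℕ} (Ω : Set (EuclideanSpace ℝ (Fin d))) (δ : ℝ) (p q : ℕ)
    (h : EuclideanSpace ℝ (Fin d)) (n : ℕ) (y : EuclideanSpace ℝ (Fin d) → ℝ) : ℝ :=
  secondEst Ω δ p q h n y / ‖Matrix.toEuclideanLin (anisotropyEst Ω δ p n y) h‖ ^ (2 * δ)

/-- The estimator of `σ = (((σ² α^δ)²) / (σ² α^{2δ}))^{1/2}`. -/
def sigmaEst {d : ℕ} (Ω : Set (EuclideanSpace ℝ (Fin d))) (δ : ℝ) (p q : ℕ)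
    (h : EuclideanSpace ℝ (Fin d)) (n : ℕ) (y : EuclideanSpace ℝ (Fin d) → ℝ) : ℝ :=
  Real.sqrt (microergodicEst Ω δ p n y ^ 2 / secondCoeffEst Ω δ p q h n y)

/-- The estimator of `α = ((σ² α^{2δ}) / (σ² α^δ))^{1/δ}`. -/
def alphaEst {d : ℕ} (Ω : Set (EuclideanSpace ℝ (Fin d))) (δ : ℝ) (p q : ℕ)
    (h : EuclideanSpace ℝ (Fin d)) (n : ℕ) (y : EuclideanSpace ℝ (Fin d) → ℝ) : ℝ :=
  (secondCoeffEst Ω δ p q h n y / microergodicEst Ω δ p n y) ^ (1 / δ)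

end IncrementEstimation

end

noncomputable section

namespace IncrementEstimation

/-! Write $A=\alpha M$. An increment of order $m$ is a Gaussian variable, and the covariance of two
increments is $\sigma^2$ times the double alternating sum `incrementCov` of the values
$e^{-|a+(i-j)b|^\delta}$, with $a=A(j-k)$ and $b=Ah/n$. Two facts about this sum carry the proof.

At lag $0$, expanding the exponential to second order gives the mean of $Q_n^m(h)$ as
$-\sigma^2|Ah|^\delta D_{m,\delta}+\tfrac12
n^{-\delta}\sigma^2|Ah|^{2\delta}D_{m,2\delta}+o(n^{-\delta})$ (`tendsto_variance_expansion`).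

At lag $a$, the sum is up to sign a difference of order $2m$ of a function holomorphic near the real
line. Cauchy estimates therefore make it $O(|b|^\delta(1+|a|/|b|)^{\delta-2m})$
(`exists_abs_incrementCov_le`). Summing squares over the grid bounds the Frobenius norm of the
covariance matrix of the increments. A sum of squares of jointly Gaussian variables concentrates
exponentially on that scale (`measure_abs_sum_sq_sub_ge_le`), so Borel–Cantelli gives $Q_n^m-\mathbb
E Q_n^m=o(n^{-\kappa})$ almost surely whenever $\kappa<\gamma/2$ for some $\gamma$ with $0<\gamma<d$
and $\gamma\le4m-2\delta$ (`ae_tendsto_rpow_mul_Q_sub`).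

With $\kappa=0$ this identifies $|Th|$, because $D_{m,\delta}<0$ (`D_neg`). The matrix $T$ then
follows by continuity of the triangular factorisation, and $\det M=1$ separates the scale from $M$.
With $\kappa=\delta$, possible when $2\delta<d$ and $\delta<m$, the second-order term is visible:
combining orders $p$ and $q$ cancels the leading term and leaves the contrast as coefficient.

A suitable $q$ exists (`exists_contrast_ne_zero`). If every contrast vanished,
$|l|^{2\delta}-c|l|^\delta$ would agree on the integers $l\ge0$ with an even polynomial of degree
$2\delta\in(0,4)$, forcing $\delta=1$. -/

/-! ### Alternating binomial sums and centred differences. -/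

/-- The alternating binomial coefficient `(-1)^i (m choose i)`. -/
def altBinom (m i : ℕ) : ℝ := (-1) ^ i * (m.choose i : ℝ)

lemma altBinom_reflect {m i : ℕ} (hi : i ≤ m) :
    altBinom m (m - i) = (-1) ^ m * altBinom m i := by
  have h1 : ((-1 : ℝ)) ^ (m - i) = (-1) ^ m * (-1) ^ i := by
    rw [← Nat.sub_add_cancel hi, Nat.add_sub_cancel, pow_add, mul_assoc, ← mul_pow]; simp
  rw [altBinom, altBinom, Nat.choose_symm hi, h1, mul_assoc]

lemma sum_altBinom {m : ℕ} (hm : 1 ≤ m) : ∑ i ∈ Finset.range (m + 1), altBinom m i = 0 := by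
  have h := Int.alternating_sum_range_choose_of_ne (n := m) (by omega)
  have h2 : ((∑ i ∈ Finset.range (m + 1), (-1 : ℤ) ^ i * (m.choose i : ℤ) : ℤ) : ℝ) = 0 := by
    rw [h]; simp
  simpa [altBinom] using h2

lemma fwdDiff_iter_eq_altBinom {G : Type*} [AddCommMonoid G] (u : G) (F : G → ℝ) (m : ℕ) (y : G) :
    (fwdDiff u)^[m] F y =
      (-1) ^ m * ∑ i ∈ Finset.range (m + 1), altBinom m i * F (y + i • u) := by
  rw [fwdDiff_iter_eq_sum_shift, Finset.mul_sum]
  refine Finset.sum_congr rfl fun i hi => ?_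
  have hi' : i ≤ m := by simpa [Nat.lt_succ_iff] using hi
  have h1 : ((-1 : ℝ)) ^ (m - i) = (-1) ^ m * (-1) ^ i := by
    rw [← Nat.sub_add_cancel hi', Nat.add_sub_cancel, pow_add, mul_assoc, ← mul_pow]; simp
  rw [altBinom, zsmul_eq_mul]
  push_cast
  rw [h1]; ring

lemma D_eq_altBinom (m : ℕ) (s : ℝ) :
    D m s = ∑ i ∈ Finset.range (m + 1), ∑ j ∈ Finset.range (m + 1),
      altBinom m i * altBinom m j * |(i : ℝ) - (j : ℝ)| ^ s := by
  refine Finset.sum_congr rfl fun i _ => Finset.sum_congr rfl fun j _ => ?_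
  rw [altBinom, altBinom, pow_add]; ring

/-- The double alternating sum of order `m` is the difference of order `2m`, centred. -/
lemma sum_sum_altBinom {G : Type*} [AddCommGroup G] (u : G) (F : G → ℝ) (m : ℕ) (x : G) :
    ∑ i ∈ Finset.range (m + 1), ∑ j ∈ Finset.range (m + 1),
      altBinom m i * altBinom m j * F (x + ((i : ℤ) - (j : ℤ)) • u) =
      (-1) ^ m * (fwdDiff u)^[2 * m] F (x - m • u) := by
  have hone : ((-1 : ℝ) ^ m) * (-1) ^ m = 1 := by rw [← mul_pow]; simp
  -- Reflecting $j\mapsto m-j$ turns the lag $i-j$ into $i+j-m$, which exhibits the double sum as a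
  -- composition of two differences of order $m$. The reflection contributes the remaining sign
  -- $(-1)^m$.
  rw [two_mul, Function.iterate_add_apply, fwdDiff_iter_eq_altBinom u _ m, ← mul_assoc, hone,
    one_mul, Finset.sum_comm, ← Finset.sum_range_reflect]
  refine Finset.sum_congr rfl fun j hj => ?_
  have hj' : j ≤ m := by simpa [Nat.lt_succ_iff] using hj
  have e1 : m + 1 - 1 - j = m - j := by omega
  rw [fwdDiff_iter_eq_altBinom, ← mul_assoc, e1, Finset.mul_sum]
  refine Finset.sum_congr rfl fun i _ => ?_
  rw [altBinom_reflect hj']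
  have e2 : x + ((i : ℤ) - ((m - j : ℕ) : ℤ)) • u = x - m • u + j • u + i • u := by
    rw [Nat.cast_sub hj', sub_smul, sub_smul, natCast_zsmul, natCast_zsmul, natCast_zsmul]; abel
  rw [e2]; ring

/-- A sequence on `ℤ` which is even and all of whose centred differences of even order vanish
at the origin is zero. -/
lemma eq_zero_of_even_of_fwdDiff {B : ℤ → ℝ} (heven : ∀ l, B (-l) = B l)
    (h : ∀ k : ℕ, (fwdDiff (1 : ℤ))^[2 * k] B (-k) = 0) (l : ℤ) : B l = 0 := by
  have key : ∀ k : ℕ, B k = 0 := by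
    intro k
    induction k using Nat.strong_induction_on with
    | _ k ih =>
      have ih' : ∀ z : ℤ, z.natAbs < k → B z = 0 := by
        intro z hz
        rcases Int.natAbs_eq z with h1 | h1
        · rw [h1]; exact ih _ hz
        · rw [h1, heven]; exact ih _ hz
      rcases Nat.eq_zero_or_pos k with rfl | hk
      · simpa using h 0
      have hk2 := h k
      -- By induction only the two end points $\pm k$ survive in the centred difference of order
      -- $2k$. Both have coefficient $1$, and evenness turns the sum into $2B(k)$.
      rw [fwdDiff_iter_eq_altBinom, Finset.sum_range_succ, Finset.sum_eq_single 0] at hk2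
      · have e : -(k : ℤ) + (2 * k) • (1 : ℤ) = k := by simp; ring
        rw [e, zero_smul, add_zero, heven, altBinom, altBinom] at hk2
        simp only [pow_mul] at hk2
        norm_num at hk2
        linarith
      · intro i hi hi0
        rw [ih', mul_zero]
        simp only [Finset.mem_range] at hi
        simp only [nsmul_eq_mul, mul_one]
        omega
      · simp; omega
  rcases Int.natAbs_eq l with h1 | h1
  · rw [h1]; exact key _
  · rw [h1, heven]; exact key _

/-! ### Negativity of $D_{m,s}$ for $0<s<2$, by a spectral representation of $|x|^s$. -/

/-- Near $0$ the integrand is $O(\xi^{1-s})$, which needs $s<2$. At infinity it is $O(\xi^{-1-s})$,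
which needs $s>0$. -/
lemma integrableOn_one_sub_cos_mul_rpow {s : ℝ} (hs0 : 0 < s) (hs2 : s < 2) (x : ℝ) :
    IntegrableOn (fun ξ : ℝ => (1 - Real.cos (x * ξ)) * ξ ^ (-1 - s)) (Set.Ioi 0) := by
  have hm : Measurable (fun ξ : ℝ => (1 - Real.cos (x * ξ)) * ξ ^ (-1 - s)) := by fun_prop
  rw [← Set.Ioc_union_Ioi_eq_Ioi (zero_le_one' ℝ)]
  refine IntegrableOn.union ?_ ?_
  · have h1 : IntegrableOn (fun ξ : ℝ => x ^ 2 / 2 * ξ ^ (1 - s)) (Set.Ioc 0 1) := by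
      refine Integrable.const_mul ?_ _
      exact (integrableOn_Ioc_iff_integrableOn_Ioo).2
        ((intervalIntegral.integrableOn_Ioo_rpow_iff one_pos).2 (by linarith))
    refine h1.mono' hm.aestronglyMeasurable ?_
    filter_upwards [ae_restrict_mem measurableSet_Ioc] with ξ hξ
    have hp : 0 < ξ := hξ.1
    have h2 := Real.one_sub_sq_div_two_le_cos (x := x * ξ)
    have h3 := Real.cos_le_one (x * ξ)
    have h4 : ξ ^ (1 - s) = ξ ^ 2 * ξ ^ (-1 - s) := by
      rw [← Real.rpow_natCast, ← Real.rpow_add hp]; congr 1; push_cast; ring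
    rw [Real.norm_eq_abs, abs_of_nonneg (mul_nonneg (by linarith) (by positivity)), h4, ← mul_assoc]
    gcongr
    nlinarith
  · have h1 : IntegrableOn (fun ξ : ℝ => 2 * ξ ^ (-1 - s)) (Set.Ioi 1) :=
      Integrable.const_mul (integrableOn_Ioi_rpow_of_lt (by linarith) one_pos) _
    refine h1.mono' hm.aestronglyMeasurable ?_
    filter_upwards [ae_restrict_mem measurableSet_Ioi] with ξ hξ
    have hp : 0 < ξ := lt_trans one_pos hξ
    have h2 := Real.neg_one_le_cos (x * ξ)
    have h3 := Real.cos_le_one (x * ξ)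
    rw [Real.norm_eq_abs, abs_of_nonneg (mul_nonneg (by linarith) (by positivity))]
    gcongr
    linarith

/-- Substitution $\eta=|x|\xi$. This makes $|x|^s$ a positive mixture of the kernels $1-\cos(x\xi)$,
up to a constant factor. -/
lemma abs_rpow_mul_integral_one_sub_cos {s : ℝ} (hs0 : 0 < s) (x : ℝ) :
    |x| ^ s * ∫ ξ in Set.Ioi (0 : ℝ), (1 - Real.cos ξ) * ξ ^ (-1 - s) =
      ∫ ξ in Set.Ioi (0 : ℝ), (1 - Real.cos (x * ξ)) * ξ ^ (-1 - s) := by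
  have hcos : ∀ ξ, Real.cos (x * ξ) = Real.cos (|x| * ξ) := by
    intro ξ
    rcases abs_choice x with h | h <;> rw [h]
    rw [neg_mul, Real.cos_neg]
  simp_rw [hcos]
  rcases (abs_nonneg x).eq_or_lt with h0 | hx
  · simp [← h0, Real.zero_rpow hs0.ne']
  have h := integral_comp_mul_left_Ioi (fun η : ℝ => (1 - Real.cos η) * η ^ (-1 - s)) 0 hx
  have h2 : ∫ ξ in Set.Ioi (0 : ℝ), (1 - Real.cos (|x| * ξ)) * (|x| * ξ) ^ (-1 - s) =
      |x| ^ (-1 - s) * ∫ ξ in Set.Ioi (0 : ℝ), (1 - Real.cos (|x| * ξ)) * ξ ^ (-1 - s) := by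
    rw [← integral_const_mul]
    refine setIntegral_congr_fun measurableSet_Ioi fun ξ hξ => ?_
    rw [Real.mul_rpow hx.le (le_of_lt hξ)]; ring
  rw [h2, mul_zero, smul_eq_mul] at h
  have h3 : |x| ^ s * |x| ^ (-1 - s) = |x|⁻¹ := by
    rw [← Real.rpow_add hx, ← Real.rpow_neg_one]; congr 1; ring
  have h4 : 0 < |x| ^ (-1 - s) := by positivity
  apply mul_left_cancel₀ h4.ne'
  rw [h, ← h3]; ring

/-- The constant $1$ drops out because the coefficients sum to zero. The addition formula turns the
rest into $-\bigl|\sum_i a_ie^{\mathrm i\,i\xi}\bigr|^2$, with $a_i$ the alternating coefficients.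
-/
lemma sum_sum_altBinom_one_sub_cos {m : ℕ} (hm : 1 ≤ m) (ξ : ℝ) :
    ∑ i ∈ Finset.range (m + 1), ∑ j ∈ Finset.range (m + 1),
      altBinom m i * altBinom m j * (1 - Real.cos (((i : ℝ) - j) * ξ)) =
    -((∑ i ∈ Finset.range (m + 1), altBinom m i * Real.cos (i * ξ)) ^ 2 +
      (∑ i ∈ Finset.range (m + 1), altBinom m i * Real.sin (i * ξ)) ^ 2) := by
  have h0 : ∑ i ∈ Finset.range (m + 1), ∑ j ∈ Finset.range (m + 1),
      altBinom m i * altBinom m j = 0 := by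
    simp_rw [← Finset.mul_sum, sum_altBinom hm, mul_zero, Finset.sum_const_zero]
  rw [sq, sq, Finset.sum_mul_sum, Finset.sum_mul_sum, ← Finset.sum_add_distrib,
    ← Finset.sum_neg_distrib, ← sub_zero (∑ i ∈ _, _), ← h0, ← Finset.sum_sub_distrib]
  refine Finset.sum_congr rfl fun i _ => ?_
  rw [← Finset.sum_add_distrib, ← Finset.sum_neg_distrib, ← Finset.sum_sub_distrib]
  refine Finset.sum_congr rfl fun j _ => ?_
  rw [sub_mul, Real.cos_sub]; ring

/-- The constants `D m s` are negative for `0 < s < 2`. -/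
lemma D_neg {m : ℕ} (hm : 1 ≤ m) {s : ℝ} (hs0 : 0 < s) (hs2 : s < 2) : D m s < 0 := by
  set c := ∫ ξ in Set.Ioi (0 : ℝ), (1 - Real.cos ξ) * ξ ^ (-1 - s) with hc
  have hc0 : 0 ≤ c := by
    refine setIntegral_nonneg measurableSet_Ioi fun ξ hξ => ?_
    have hp : 0 < ξ := hξ
    exact mul_nonneg (by linarith [Real.cos_le_one ξ]) (by positivity)
  set A : ℝ → ℝ := fun ξ => ∑ i ∈ Finset.range (m + 1), altBinom m i * Real.cos (i * ξ) with hA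
  set B : ℝ → ℝ := fun ξ => ∑ i ∈ Finset.range (m + 1), altBinom m i * Real.sin (i * ξ) with hB
  have hint : ∀ i j : ℕ, IntegrableOn (fun ξ : ℝ => altBinom m i * altBinom m j *
      ((1 - Real.cos (((i : ℝ) - j) * ξ)) * ξ ^ (-1 - s))) (Set.Ioi 0) := fun i j =>
    (integrableOn_one_sub_cos_mul_rpow hs0 hs2 _).const_mul _
  have hsum : ∀ ξ : ℝ, ∑ i ∈ Finset.range (m + 1), ∑ j ∈ Finset.range (m + 1),
      altBinom m i * altBinom m j * ((1 - Real.cos (((i : ℝ) - j) * ξ)) * ξ ^ (-1 - s)) =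
      -((A ξ ^ 2 + B ξ ^ 2) * ξ ^ (-1 - s)) := by
    intro ξ
    rw [← neg_mul, ← sum_sum_altBinom_one_sub_cos hm, Finset.sum_mul]
    refine Finset.sum_congr rfl fun i _ => ?_
    rw [Finset.sum_mul]
    exact Finset.sum_congr rfl fun j _ => by ring
  have hI : IntegrableOn (fun ξ => (A ξ ^ 2 + B ξ ^ 2) * ξ ^ (-1 - s)) (Set.Ioi 0) := by
    have := (integrable_finsetSum (μ := volume.restrict (Set.Ioi (0 : ℝ)))
      (Finset.range (m + 1)) fun i _ => integrable_finsetSum (Finset.range (m + 1))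
        fun j _ => hint i j).neg
    refine this.congr (ae_of_all _ fun ξ => ?_)
    simp only [Pi.neg_apply]
    rw [hsum, neg_neg]
  have hD : D m s * c = -∫ ξ in Set.Ioi (0 : ℝ), (A ξ ^ 2 + B ξ ^ 2) * ξ ^ (-1 - s) := by
    rw [← integral_neg]
    simp_rw [← hsum]
    rw [integral_finsetSum _ fun i _ => integrable_finsetSum _ fun j _ => hint i j,
      D_eq_altBinom, Finset.sum_mul]
    refine Finset.sum_congr rfl fun i _ => ?_
    rw [integral_finsetSum _ fun j _ => hint i j, Finset.sum_mul]
    refine Finset.sum_congr rfl fun j _ => ?_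
    rw [integral_const_mul, ← abs_rpow_mul_integral_one_sub_cos hs0, mul_assoc]
  have hpos : 0 < ∫ ξ in Set.Ioi (0 : ℝ), (A ξ ^ 2 + B ξ ^ 2) * ξ ^ (-1 - s) := by
    rw [setIntegral_pos_iff_support_of_nonneg_ae _ hI]
    · have hAc : Continuous A := by rw [hA]; fun_prop
      have ho : IsOpen ({ξ | A ξ ≠ 0} ∩ Set.Ioi 0) :=
        (isOpen_ne_fun hAc continuous_const).inter isOpen_Ioi
      have hne : ({ξ | A ξ ≠ 0} ∩ Set.Ioi 0).Nonempty := by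
        -- At $\xi=\pi$ the cosines cancel the alternating signs, so the sum is $\sum_i\binom
        -- mi=2^m$.
        refine ⟨Real.pi, ?_, Real.pi_pos⟩
        have : A Real.pi = 2 ^ m := by
          have h2 := Nat.sum_range_choose m
          rw [hA]
          simp only [Real.cos_nat_mul_pi, altBinom]
          rw [← Nat.cast_two, ← Nat.cast_pow, ← h2, Nat.cast_sum]
          refine Finset.sum_congr rfl fun i _ => ?_
          rw [mul_right_comm, ← mul_pow]; simp
        simp [this]
      refine lt_of_lt_of_le (ho.measure_pos volume hne) (measure_mono ?_)
      rintro ξ ⟨h1, h2⟩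
      refine ⟨?_, h2⟩
      have hp : (0 : ℝ) < ξ := h2
      have h1' : A ξ ≠ 0 := h1
      have : 0 < (A ξ ^ 2 + B ξ ^ 2) * ξ ^ (-1 - s) := by positivity
      exact this.ne'
    · filter_upwards [ae_restrict_mem measurableSet_Ioi] with ξ hξ
      have hp : (0 : ℝ) < ξ := hξ
      simp only [Pi.zero_apply]
      positivity
  -- Only $c\ge0$ is needed: $D\ge0$ would give $Dc\ge0$, whereas $Dc$ is minus a positive integral.
  by_contra hcon
  push Not at hcon
  nlinarith [mul_nonneg hcon hc0]

/-! ### Choice of $q$ with a nonzero contrast. -/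

/-- A function on `ℤ` with a vanishing iterated difference is given on each half line by a
polynomial. -/
lemma exists_polynomial_of_fwdDiff_eq_zero {b : ℤ → ℝ} {N : ℕ}
    (h : ∀ l, (fwdDiff (1 : ℤ))^[N] b l = 0) (y : ℤ) :
    ∃ R : Polynomial ℝ, ∀ n : ℕ, R.eval (n : ℝ) = b (y + n) := by
  have hz : ∀ k, N ≤ k → ∀ l, (fwdDiff (1 : ℤ))^[k] b l = 0 := by
    intro k hk
    obtain ⟨r, rfl⟩ := Nat.exists_eq_add_of_le' hk
    intro l
    rw [Function.iterate_add_apply, fwdDiff_iter_eq_altBinom]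
    simp [h]
  -- Newton's forward difference formula, with $\binom nk$ written as a falling factorial over $k!$
  -- so that it is a polynomial in $n$.
  refine ⟨∑ k ∈ Finset.range N, Polynomial.C ((fwdDiff (1 : ℤ))^[k] b y / (k.factorial : ℝ)) *
    descPochhammer ℝ k, fun n => ?_⟩
  have h1 := shift_eq_sum_fwdDiff_iter (1 : ℤ) b n y
  simp only [nsmul_eq_mul, mul_one] at h1
  rw [h1, Polynomial.eval_finsetSum]
  have h2 : ∀ k, Polynomial.eval (n : ℝ) (Polynomial.C ((fwdDiff (1 : ℤ))^[k] b y /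
      (k.factorial : ℝ)) * descPochhammer ℝ k) = (n.choose k : ℝ) * (fwdDiff (1 : ℤ))^[k] b y := by
    intro k
    have hk : (k.factorial : ℝ) ≠ 0 := by positivity
    rw [Polynomial.eval_mul, Polynomial.eval_C, descPochhammer_eval_eq_descFactorial,
      Nat.descFactorial_eq_factorial_mul_choose]
    push_cast
    field_simp
  simp_rw [h2]
  rcases le_total N (n + 1) with hN | hN
  · refine Finset.sum_subset (Finset.range_mono hN) fun k _ hk => ?_
    rw [hz k (by simpa using hk), mul_zero]
  · refine (Finset.sum_subset (Finset.range_mono hN) fun k _ hk => ?_).symm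
    rw [Nat.choose_eq_zero_of_lt (by simpa using hk)]; simp

/-- The polynomial based at $-L$ and the one based at $0$ represent the same values on a half line,
so they agree up to translation. Evaluating at $-L$ gives $R(-L)=b(-L)=b(L)=R(L)$ for every natural
number $L$. -/
lemma exists_even_polynomial_of_fwdDiff_eq_zero {b : ℤ → ℝ} (heven : ∀ l, b (-l) = b l) {N : ℕ}
    (h : ∀ l, (fwdDiff (1 : ℤ))^[N] b l = 0) :
    ∃ R : Polynomial ℝ, (∀ n : ℕ, R.eval (n : ℝ) = b n) ∧ R.comp (-Polynomial.X) = R := by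
  obtain ⟨R, hR⟩ := exists_polynomial_of_fwdDiff_eq_zero h 0
  simp only [zero_add] at hR
  have hinf : (Set.range (fun n : ℕ => (n : ℝ))).Infinite :=
    Set.infinite_range_of_injective Nat.cast_injective
  refine ⟨R, hR, Polynomial.eq_of_infinite_eval_eq _ _ (hinf.mono ?_)⟩
  rintro _ ⟨L, rfl⟩
  obtain ⟨R', hR'⟩ := exists_polynomial_of_fwdDiff_eq_zero h (-(L : ℤ))
  have hcomp : R' = R.comp (Polynomial.X - Polynomial.C (L : ℝ)) := by
    refine Polynomial.eq_of_infinite_eval_eq _ _ ((hinf.image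
      (f := fun x : ℝ => x + L) (fun a _ b _ hab => by simpa using hab)).mono ?_)
    rintro _ ⟨_, ⟨n, rfl⟩, rfl⟩
    have h1 := hR' (n + L)
    simp only [Set.mem_ofPred_eq, Polynomial.eval_comp, Polynomial.eval_sub, Polynomial.eval_X,
      Polynomial.eval_C, add_sub_cancel_right]
    rw [hR n, ← Nat.cast_add, h1]
    congr 1; push_cast; ring
  have h2 := hR' 0
  simp only [hcomp, Polynomial.eval_comp, Nat.cast_zero, Polynomial.eval_sub, Polynomial.eval_X,
      Polynomial.eval_C, zero_sub, add_zero, heven] at h2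
  simp only [Set.mem_ofPred_eq, Polynomial.eval_comp, Polynomial.eval_neg, Polynomial.eval_X]
  rw [h2, hR]

/-- Comparison of growth: $R(n)/n^{2\delta}\to1$, while $R(n)$ is asymptotic to its leading term. -/
lemma natDegree_of_eval_eq_rpow {δ c : ℝ} (hδ : 0 < δ) {R : Polynomial ℝ}
    (hR : ∀ n : ℕ, R.eval (n : ℝ) = (n : ℝ) ^ (2 * δ) - c * (n : ℝ) ^ δ) :
    (R.natDegree : ℝ) = 2 * δ := by
  have h1 := (Polynomial.isEquivalent_atTop_lead R).comp_tendsto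
    (tendsto_natCast_atTop_atTop (R := ℝ))
  have hlim : Tendsto (fun n : ℕ => R.eval (n : ℝ) / (n : ℝ) ^ (2 * δ)) atTop (𝓝 1) := by
    have h2 : Tendsto (fun n : ℕ => 1 - c * (n : ℝ) ^ (-δ)) atTop (𝓝 (1 - c * 0)) :=
      ((((tendsto_rpow_neg_atTop hδ).comp tendsto_natCast_atTop_atTop).const_mul c).const_sub 1)
    rw [mul_zero, sub_zero] at h2
    refine h2.congr' ?_
    filter_upwards [eventually_gt_atTop 0] with n hn
    have hp : (0 : ℝ) < n := by exact_mod_cast hn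
    rw [hR, sub_div, div_self (by positivity), mul_div_assoc, ← Real.rpow_sub hp]
    congr 3; ring
  have hR0 : R.leadingCoeff ≠ 0 := by
    intro h0
    rw [Polynomial.leadingCoeff_eq_zero] at h0
    simp [h0] at hlim
  have hlim2 : Tendsto (fun n : ℕ => R.leadingCoeff * (n : ℝ) ^ (R.natDegree - 2 * δ : ℝ)) atTop
      (𝓝 1) := by
    have h3 : Asymptotics.IsEquivalent atTop (fun n : ℕ => R.eval (n : ℝ) / (n : ℝ) ^ (2 * δ))
        (fun n : ℕ => R.leadingCoeff * (n : ℝ) ^ R.natDegree / (n : ℝ) ^ (2 * δ)) :=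
      h1.div Asymptotics.IsEquivalent.refl
    refine (h3.tendsto_nhds hlim).congr' ?_
    filter_upwards [eventually_gt_atTop 0] with n hn
    have hp : (0 : ℝ) < n := by exact_mod_cast hn
    rw [Real.rpow_sub hp, Real.rpow_natCast, mul_div_assoc]
  rcases lt_trichotomy ((R.natDegree : ℝ) - 2 * δ) 0 with h | h | h
  · exfalso
    have h4 : Tendsto (fun n : ℕ => R.leadingCoeff * (n : ℝ) ^ (R.natDegree - 2 * δ : ℝ)) atTop
        (𝓝 (R.leadingCoeff * 0)) := by
      have := ((tendsto_rpow_neg_atTop (neg_pos.2 h)).comp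
        (tendsto_natCast_atTop_atTop (R := ℝ))).const_mul R.leadingCoeff
      simpa [Function.comp_def] using this
    have := tendsto_nhds_unique h4 hlim2
    simp at this
  · linarith
  · exfalso
    have h5 : Tendsto (fun n : ℕ => |R.leadingCoeff * (n : ℝ) ^ (R.natDegree - 2 * δ : ℝ)|) atTop
        atTop := by
      simp_rw [abs_mul]
      refine Tendsto.const_mul_atTop (abs_pos.2 hR0) ?_
      exact tendsto_abs_atTop_atTop.comp ((tendsto_rpow_atTop h).comp tendsto_natCast_atTop_atTop)
    exact not_tendsto_nhds_of_tendsto_atTop h5 _ hlim2.abs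

/-- The order `q` can be chosen so that the contrast does not vanish. -/
lemma exists_contrast_ne_zero {δ : ℝ} (hδ0 : 0 < δ) (hδ2 : δ < 2) (hδ1 : δ ≠ 1) {p : ℕ}
    (hp : 1 ≤ p) : ∃ q, p < q ∧ contrast p q δ ≠ 0 := by
  by_contra hcon
  push Not at hcon
  have hpD := (D_neg hp hδ0 hδ2).ne
  set c := D p (2 * δ) / D p δ with hc
  have hD : ∀ q, p ≤ q → D q (2 * δ) - c * D q δ = 0 := by
    intro q hq
    rcases hq.eq_or_lt with rfl | hq
    · rw [hc]; field_simp; ring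
    have h1 := hcon q hq
    have hqD := (D_neg (hp.trans hq.le) hδ0 hδ2).ne
    rw [contrast] at h1
    rw [hc]
    field_simp at h1 ⊢
    linarith
  -- The sequence is chosen so that its centred difference of order $2q$ at the origin is, up to
  -- sign, $D_{q,2\delta}-cD_{q,\delta}$. This vanishes at $q=p$ by the choice of $c$, and for $q>p$
  -- by the assumption on the contrasts.
  set b : ℤ → ℝ := fun l => |(l : ℝ)| ^ (2 * δ) - c * |(l : ℝ)| ^ δ with hb
  have hbeven : ∀ l, b (-l) = b l := by intro l; simp [hb]
  have hbD : ∀ q : ℕ, (-1) ^ q * (fwdDiff (1 : ℤ))^[2 * q] b (-q) = D q (2 * δ) - c * D q δ := by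
    intro q
    have h1 := sum_sum_altBinom (1 : ℤ) b q 0
    simp only [zero_sub, nsmul_eq_mul, mul_one] at h1
    rw [← h1, D_eq_altBinom, D_eq_altBinom, Finset.mul_sum, ← Finset.sum_sub_distrib]
    refine Finset.sum_congr rfl fun i _ => ?_
    rw [Finset.mul_sum, ← Finset.sum_sub_distrib]
    refine Finset.sum_congr rfl fun j _ => ?_
    simp [hb]; ring
  have hb0 : ∀ q : ℕ, p ≤ q → (fwdDiff (1 : ℤ))^[2 * q] b (-q) = 0 := by
    intro q hq
    have h1 := hbD q
    rw [hD q hq] at h1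
    simpa using h1
  -- Up to sign, the centred difference of order $2p$ of $b$. It is even, and its centred difference
  -- of order $2k$ at $0$ is, up to sign, the one of $b$ of order $2(k+p)$, which vanishes. Hence
  -- $B=0$ and $b$ is polynomial on the half line.
  set B : ℤ → ℝ := fun x => ∑ i ∈ Finset.range (p + 1), ∑ j ∈ Finset.range (p + 1),
      altBinom p i * altBinom p j * b (x + ((i : ℤ) - (j : ℤ)) • 1) with hB
  have hB1 : ∀ x, B x = (-1) ^ p * (fwdDiff (1 : ℤ))^[2 * p] b (x - p) := by
    intro x
    have := sum_sum_altBinom (1 : ℤ) b p x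
    simpa [hB] using this
  have hB1' : B = ((-1 : ℝ) ^ p) • fun x => (fwdDiff (1 : ℤ))^[2 * p] b (x + -p) := by
    funext x; simp [hB1, sub_eq_add_neg]
  have hBeven : ∀ x, B (-x) = B x := by
    intro x
    simp only [hB]
    rw [Finset.sum_comm]
    refine Finset.sum_congr rfl fun i _ => Finset.sum_congr rfl fun j _ => ?_
    rw [← hbeven]
    congr 1
    · ring
    · congr 1; simp; ring
  have hBzero := eq_zero_of_even_of_fwdDiff hBeven (fun k => by
    rw [hB1', fwdDiff_iter_const_smul, Pi.smul_apply, fwdDiff_iter_comp_add (1 : ℤ)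
      ((fwdDiff (1 : ℤ))^[2 * p] b), ← Function.iterate_add_apply, ← mul_add]
    have h1 := hb0 (k + p) (by omega)
    have e : -(k : ℤ) + -(p : ℤ) = -((k + p : ℕ) : ℤ) := by push_cast; ring
    rw [e, h1, smul_zero])
  obtain ⟨R, hR, hRc⟩ := exists_even_polynomial_of_fwdDiff_eq_zero hbeven (N := 2 * p) (fun l => by
    have h1 := hB1 (l + p)
    rw [hBzero, add_sub_cancel_right] at h1
    simpa using h1.symm)
  have hdeg := natDegree_of_eval_eq_rpow (c := c) hδ0 (R := R) (fun n => by
    rw [hR]; simp [hb])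
  have hR0 : R.leadingCoeff ≠ 0 := by
    intro h0
    rw [Polynomial.leadingCoeff_eq_zero] at h0
    simp [h0] at hdeg
    linarith
  have hlead : (-1 : ℝ) ^ R.natDegree = 1 := by
    have h1 := congrArg Polynomial.leadingCoeff hRc
    rw [Polynomial.leadingCoeff_comp (by simp)] at h1
    simp only [Polynomial.leadingCoeff_neg, Polynomial.leadingCoeff_X] at h1
    exact mul_left_cancel₀ hR0 (by rw [h1, mul_one])
  have hlt : R.natDegree < 4 := by
    have : (R.natDegree : ℝ) < 4 := by linarith
    exact_mod_cast this
  generalize R.natDegree = N at hdeg hlead hlt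
  -- Evenness rules out degrees $1$ and $3$, degree $0$ contradicts $\delta>0$, and degree $2$ means
  -- $\delta=1$.
  interval_cases N
  · norm_num at hdeg; linarith
  · norm_num at hlead
  · apply hδ1; norm_num at hdeg; linarith
  · norm_num at hlead

/-! ### Exponential concentration of Gaussian sums of squares. -/

/-- A quadratic lower bound for $\log(1-y)$, applied below with $y=2tv$ to the factor
$(1-2tv)^{-1/2}$ of the moment generating function. -/
lemma exp_neg_sub_sq_le {y : ℝ} (hy : |y| ≤ 1 / 4) : Real.exp (-(y + y ^ 2)) ≤ 1 - y := by
  obtain ⟨h1, h2⟩ := abs_le.1 hy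
  rcases le_total y 0 with h | h
  · have h3 : 0 < 1 + (y + y ^ 2) := by nlinarith
    rw [Real.exp_neg]
    refine (inv_anti₀ h3 (by linarith [Real.add_one_le_exp (y + y ^ 2)])).trans ?_
    rw [inv_eq_one_div, div_le_iff₀ h3]
    nlinarith [pow_nonneg (neg_nonneg.2 h) 3]
  · have h3 : 0 ≤ y + y ^ 2 := by positivity
    have h4 := Real.quadratic_le_exp_of_nonneg h3
    have h5 : 0 < 1 - y := by linarith
    rw [Real.exp_neg]
    refine inv_le_of_inv_le₀ h5 (le_trans ?_ h4)
    rw [inv_eq_one_div, div_le_iff₀ h5]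
    nlinarith [mul_nonneg h h, mul_nonneg (mul_nonneg h h) h, mul_nonneg (mul_nonneg (mul_nonneg h h) h) h]

lemma integrable_exp_mul_sq_gaussianReal {v : NNReal} {t : ℝ} (h : t * v ≤ 1 / 8) :
    Integrable (fun x : ℝ => Real.exp (t * x ^ 2)) (gaussianReal 0 v) := by
  rcases eq_or_ne v 0 with rfl | hv
  · rw [gaussianReal_zero_var]; exact integrable_dirac (by simp)
  have hv' : (0 : ℝ) < v := by positivity
  have hb : 0 < 1 / (2 * (v : ℝ)) - t := by
    rw [sub_pos, lt_div_iff₀ (by positivity)]; linarith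
  rw [gaussianReal_of_var_ne_zero _ hv,
    integrable_withDensity_iff_integrable_smul' (measurable_gaussianPDF _ _)
      (ae_of_all _ fun _ => gaussianPDF_lt_top)]
  refine ((integrable_exp_neg_mul_sq hb).const_mul (√(2 * Real.pi * v))⁻¹).congr
    (ae_of_all _ fun x => ?_)
  beta_reduce
  rw [toReal_gaussianPDF, gaussianPDFReal, smul_eq_mul, mul_assoc (_⁻¹), ← Real.exp_add]
  congr 2
  field_simp; ring

/-- The Gaussian integral is exactly $e^{-tv}(1-2tv)^{-1/2}$. The linear terms in $tv$ cancel
because the square is centred. -/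
lemma mgf_sq_sub_gaussianReal_le {v : NNReal} {t : ℝ} (h : |t * v| ≤ 1 / 8) :
    ∫ x, Real.exp (t * (x ^ 2 - v)) ∂(gaussianReal 0 v) ≤ Real.exp (2 * (t * v) ^ 2) := by
  rcases eq_or_ne v 0 with rfl | hv
  · rw [gaussianReal_zero_var, integral_dirac]; simp
  have hv' : (0 : ℝ) < v := by positivity
  have htv := (abs_le.1 h).2
  have hb : 0 < 1 / (2 * (v : ℝ)) - t := by
    rw [sub_pos, lt_div_iff₀ (by positivity)]; linarith
  rw [integral_gaussianReal_eq_integral_smul hv]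
  have h1 : ∀ x : ℝ, gaussianPDFReal 0 v x • Real.exp (t * (x ^ 2 - v)) =
      (√(2 * Real.pi * v))⁻¹ * Real.exp (-(t * v)) *
        Real.exp (-(1 / (2 * (v : ℝ)) - t) * x ^ 2) := by
    intro x
    simp only [gaussianPDFReal, smul_eq_mul]
    rw [mul_assoc (_⁻¹), mul_assoc (_⁻¹), ← Real.exp_add, ← Real.exp_add]
    congr 2
    field_simp; ring
  simp_rw [h1]
  rw [integral_const_mul, integral_gaussian]
  have hy : |2 * (t * v)| ≤ 1 / 4 := by rw [abs_mul, abs_two]; linarith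
  have h2 := exp_neg_sub_sq_le hy
  have h3 : 0 < 1 - 2 * (t * v) := by linarith
  have h4 : √(Real.pi / (1 / (2 * (v : ℝ)) - t)) = √(2 * Real.pi * v) * (√(1 - 2 * (t * v)))⁻¹ := by
    rw [← Real.sqrt_inv, ← Real.sqrt_mul (by positivity)]
    congr 1
    have : 1 / (2 * (v : ℝ)) - t = (1 - 2 * (t * v)) / (2 * v) := by field_simp
    rw [this]; field_simp
  have h5 : 0 < √(2 * Real.pi * v) := by positivity
  rw [h4]
  have h6 : (√(2 * Real.pi * v))⁻¹ * Real.exp (-(t * v)) *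
      (√(2 * Real.pi * v) * (√(1 - 2 * (t * v)))⁻¹) =
      Real.exp (-(t * v)) * (√(1 - 2 * (t * v)))⁻¹ := by field_simp
  rw [h6]
  have h7 : Real.exp (-(t * v) - 2 * (t * v) ^ 2) ≤ √(1 - 2 * (t * v)) := by
    refine Real.le_sqrt_of_sq_le (le_trans (le_of_eq ?_) h2)
    rw [← Real.exp_nat_mul]; congr 1; push_cast; ring
  calc Real.exp (-(t * v)) * (√(1 - 2 * (t * v)))⁻¹
      ≤ Real.exp (-(t * v)) * (Real.exp (-(t * v) - 2 * (t * v) ^ 2))⁻¹ := by gcongr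
    _ = Real.exp (2 * (t * v) ^ 2) := by rw [← Real.exp_neg, ← Real.exp_add]; congr 1; ring

section Gaussian

variable {S : Type*} [MeasurableSpace S] {P : Measure S}

/-- Exponential concentration of a sum of squares of independent centred Gaussians. -/
lemma measure_abs_sum_sq_sub_ge_le_of_iIndepFun [IsProbabilityMeasure P] {ι : Type*} [Fintype ι]
    {W : ι → S → ℝ} {v : ι → NNReal} (hind : iIndepFun W P) (hm : ∀ i, AEMeasurable (W i) P)
    (hlaw : ∀ i, P.map (W i) = gaussianReal 0 (v i)) {F : ℝ} (hF : 0 < F)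
    (hv : ∑ i, (v i : ℝ) ^ 2 ≤ F ^ 2) (t : ℝ) :
    P.real {ω | t ≤ |∑ i, (W i ω ^ 2 - v i)|} ≤ 4 * Real.exp (-t / (8 * F)) := by
  have hvF : ∀ i, (v i : ℝ) ≤ F := fun i => by
    refine le_of_sq_le_sq ((Finset.single_le_sum (f := fun i => (v i : ℝ) ^ 2)
      (fun j _ => sq_nonneg _) (Finset.mem_univ i)).trans hv) hF.le
  set X : ι → S → ℝ := fun i ω => W i ω ^ 2 - v i with hX
  have hXm : ∀ i, AEMeasurable (X i) P := fun i => ((hm i).pow_const 2).sub_const _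
  have hXind : iIndepFun X P :=
    hind.comp (fun i x => x ^ 2 - (v i : ℝ)) fun i => by fun_prop
  -- At $|\theta|=1/(8F)$ every $|\theta v_i|$ is at most $1/8$ and $2\theta^2\sum_i v_i^2$ is at
  -- most $1/32$, so the moment generating function is bounded by an absolute constant.
  have hθ : ∀ θ : ℝ, |θ| = 1 / (8 * F) → mgf (∑ i, X i) P θ ≤ 2 ∧
      Integrable (fun ω => Real.exp (θ * (∑ i, X i) ω)) P := by
    intro θ hθ
    have hb : ∀ i, |θ * v i| ≤ 1 / 8 := by
      intro i
      rw [abs_mul, hθ, NNReal.abs_eq, div_mul_eq_mul_div, one_mul, div_le_div_iff₀ (by positivity)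
        (by norm_num)]
      linarith [hvF i]
    have hi : ∀ i, mgf (X i) P θ ≤ Real.exp (2 * (θ * v i) ^ 2) := by
      intro i
      refine le_trans (le_of_eq ?_) (mgf_sq_sub_gaussianReal_le (hb i))
      rw [← hlaw i, integral_map (hm i) (by fun_prop)]
      rfl
    have hpos : ∀ i, 0 < mgf (X i) P θ := by
      intro i
      refine mgf_pos ?_
      have h1 := integrable_exp_mul_sq_gaussianReal (abs_le.1 (hb i)).2
      rw [← hlaw i, integrable_map_measure (by fun_prop) (hm i)] at h1
      refine (h1.mul_const (Real.exp (-(θ * v i)))).congr (ae_of_all _ fun ω => ?_)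
      simp only [Function.comp_apply, hX]
      rw [← Real.exp_add]; congr 1; ring
    have hmgf : mgf (∑ i, X i) P θ = ∏ i, mgf (X i) P θ := hXind.mgf_sum₀ hXm _
    constructor
    · rw [hmgf]
      calc ∏ i, mgf (X i) P θ ≤ ∏ i, Real.exp (2 * (θ * v i) ^ 2) :=
            Finset.prod_le_prod (fun i _ => (hpos i).le) fun i _ => hi i
        _ = Real.exp (2 * θ ^ 2 * ∑ i, (v i : ℝ) ^ 2) := by
            rw [← Real.exp_sum, Finset.mul_sum]; congr 1
            exact Finset.sum_congr rfl fun i _ => by ring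
        _ ≤ Real.exp (1 / 2) := by
            apply Real.exp_le_exp.2
            rw [← sq_abs θ, hθ]
            calc 2 * (1 / (8 * F)) ^ 2 * ∑ i, (v i : ℝ) ^ 2 ≤ 2 * (1 / (8 * F)) ^ 2 * F ^ 2 := by
                  gcongr
              _ ≤ 1 / 2 := by field_simp; norm_num
        _ ≤ 2 := by
            rw [← Real.le_log_iff_exp_le two_pos]; linarith [Real.log_two_gt_d9]
    -- A non-integrable exponential would have `mgf` equal to $0$ by convention, but here it is a
    -- product of positive factors.
    · by_contra hcon
      have h0 := mgf_undef hcon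
      rw [hmgf, Finset.prod_eq_zero_iff] at h0
      obtain ⟨i, _, h0⟩ := h0
      exact (hpos i).ne' h0
  have hsum : ∀ ω, (∑ i, X i) ω = ∑ i, (W i ω ^ 2 - v i) := fun ω => by
    simp [hX]
  have hF8 : 0 < 1 / (8 * F) := by positivity
  obtain ⟨hp1, hp2⟩ := hθ (1 / (8 * F)) (abs_of_pos hF8)
  obtain ⟨hn1, hn2⟩ := hθ (-(1 / (8 * F))) (by rw [abs_neg, abs_of_pos hF8])
  have hup := measure_ge_le_exp_mul_mgf (μ := P) t hF8.le hp2
  have hdn := measure_le_le_exp_mul_mgf (μ := P) (-t) (neg_nonpos.2 hF8.le) hn2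
  have hsub : {ω | t ≤ |∑ i, (W i ω ^ 2 - v i)|} ⊆
      {ω | t ≤ (∑ i, X i) ω} ∪ {ω | (∑ i, X i) ω ≤ -t} := by
    intro ω hω
    rcases le_abs.1 (show t ≤ |∑ i, (W i ω ^ 2 - v i)| from hω) with h | h
    · left; show t ≤ _; rw [hsum]; exact h
    · right; show _ ≤ -t; rw [hsum]; linarith
  have e1 : -(1 / (8 * F)) * t = -t / (8 * F) := by ring
  have e2 : -(-(1 / (8 * F))) * -t = -t / (8 * F) := by ring
  rw [e1] at hup
  rw [e2] at hdn
  have h3 := (measureReal_mono (μ := P) hsub (by finiteness)).trans (measureReal_union_le _ _)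
  have h4 : 0 < Real.exp (-t / (8 * F)) := Real.exp_pos _
  nlinarith

/-- Exponential concentration of a sum of squares of jointly Gaussian centred variables, in terms
of the Frobenius norm of the covariance matrix. -/
lemma measure_abs_sum_sq_sub_ge_le [IsProbabilityMeasure P] {ι : Type*} [Fintype ι]
    {Z : ι → S → ℝ} (hZ : HasGaussianLaw (fun ω => (Z · ω)) P) (hmean : ∀ i, ∫ ω, Z i ω ∂P = 0)
    {F : ℝ} (hF : 0 < F) (hv : ∑ i, ∑ j, cov[Z i, Z j; P] ^ 2 ≤ F ^ 2) (t : ℝ) :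
    P.real {ω | t ≤ |∑ i, (Z i ω ^ 2 - cov[Z i, Z i; P])|} ≤ 4 * Real.exp (-t / (8 * F)) := by
  classical
  set V : Matrix ι ι ℝ := Matrix.of fun i j => cov[Z i, Z j; P] with hVdef
  have hV : V.IsHermitian := by
    ext i j; simp [hVdef, covariance_comm (Z i)]
  have hL2 : ∀ i, MemLp (Z i) 2 P := fun i => (hZ.eval i).memLp_two
  set U : Matrix ι ι ℝ := (hV.eigenvectorUnitary : Matrix ι ι ℝ) with hU
  have hUU : U.transpose * U = 1 := Unitary.coe_star_mul_self hV.eigenvectorUnitary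
  have hUU' : U * U.transpose = 1 := Unitary.coe_mul_star_self hV.eigenvectorUnitary
  have hdiag : U.transpose * V * U = Matrix.diagonal hV.eigenvalues := by
    have h1 := hV.conjStarAlgAut_star_eigenvectorUnitary
    rw [Unitary.conjStarAlgAut_apply] at h1
    simpa [Matrix.star_eq_conjTranspose, hU] using h1
  -- Coordinates in an orthonormal eigenbasis of the covariance matrix are uncorrelated, hence
  -- independent by joint Gaussianity. The rotation preserves the sum of squares, the trace and the
  -- Frobenius norm, so the independent case applies.
  set W : ι → S → ℝ := fun a ω => ∑ i, U i a * Z i ω with hW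
  have hWlaw : HasGaussianLaw (fun ω => (W · ω)) P := by
    have h1 := hZ.map_fun (Matrix.mulVecLin U.transpose).toContinuousLinearMap
    convert! h1 using 2
  have hWcov : ∀ a b, cov[W a, W b; P] = Matrix.diagonal hV.eigenvalues a b := by
    intro a b
    rw [← hdiag]
    simp only [hW]
    rw [covariance_fun_sum_fun_sum (fun i => (hL2 i).const_mul _) (fun i => (hL2 i).const_mul _)]
    simp only [covariance_const_mul_left, covariance_const_mul_right, Matrix.mul_apply,
      Matrix.transpose_apply, Finset.sum_mul]
    rw [Finset.sum_comm]
    refine Finset.sum_congr rfl fun i _ => Finset.sum_congr rfl fun j _ => ?_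
    simp [hVdef]; ring
  have hWmean : ∀ a, ∫ ω, W a ω ∂P = 0 := by
    intro a
    simp only [hW]
    rw [integral_finsetSum _ fun i _ => (((hL2 i).integrable (by norm_num)).const_mul _)]
    simp [integral_const_mul, hmean]
  have hind : iIndepFun W P := hWlaw.iIndepFun_of_covariance_eq_zero fun a b hab => by
    rw [hWcov, Matrix.diagonal_apply_ne _ hab]
  have hWm : ∀ a, AEMeasurable (W a) P := fun a => (hWlaw.eval a).aemeasurable
  have hvar : ∀ a, Var[W a; P] = hV.eigenvalues a := by
    intro a
    rw [← covariance_self (hWm a), hWcov, Matrix.diagonal_apply_eq]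
  have hev : ∀ a, 0 ≤ hV.eigenvalues a := fun a => by rw [← hvar]; exact variance_nonneg _ _
  have hsumsq : ∑ a, hV.eigenvalues a ^ 2 = ∑ i, ∑ j, cov[Z i, Z j; P] ^ 2 := by
    have h1 : (V * V).trace = (Matrix.diagonal hV.eigenvalues * Matrix.diagonal hV.eigenvalues).trace := by
      rw [← hdiag]
      calc (V * V).trace = (V * V * (U * U.transpose)).trace := by rw [hUU', Matrix.mul_one]
        _ = (U.transpose * (V * V * U)).trace := by
            rw [← Matrix.mul_assoc, Matrix.trace_mul_comm]
        _ = (U.transpose * (V * (U * U.transpose) * V * U)).trace := by rw [hUU', Matrix.mul_one]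
        _ = _ := by congr 1; simp only [Matrix.mul_assoc]
    rw [Matrix.diagonal_mul_diagonal, Matrix.trace_diagonal] at h1
    simp only [sq]
    rw [← h1, Matrix.trace]
    refine Finset.sum_congr rfl fun i _ => ?_
    rw [Matrix.diag_apply, Matrix.mul_apply]
    refine Finset.sum_congr rfl fun j _ => ?_
    simp [hVdef, covariance_comm (Z j)]
  have htr : ∑ a, hV.eigenvalues a = ∑ i, cov[Z i, Z i; P] := by
    have h1 : V.trace = (Matrix.diagonal hV.eigenvalues).trace := by
      rw [← hdiag, Matrix.trace_mul_comm, ← Matrix.mul_assoc, hUU', Matrix.one_mul]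
    rw [Matrix.trace_diagonal] at h1
    exact h1.symm
  have hsq : ∀ ω, ∑ a, W a ω ^ 2 = ∑ i, Z i ω ^ 2 := by
    intro ω
    have h1 : (fun a => W a ω) = U.transpose.mulVec (fun i => Z i ω) := by
      ext a; simp [hW, Matrix.mulVec, dotProduct]
    have h2 : dotProduct (fun a => W a ω) (fun a => W a ω) =
        dotProduct (fun i => Z i ω) (fun i => Z i ω) := by
      rw [h1, Matrix.dotProduct_mulVec, Matrix.vecMul_transpose, Matrix.mulVec_mulVec, hUU',
        Matrix.one_mulVec]
    simpa [dotProduct, sq] using h2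
  have hmain := measure_abs_sum_sq_sub_ge_le_of_iIndepFun hind hWm
    (v := fun a => (hV.eigenvalues a).toNNReal) (fun a => by
      rw [(hWlaw.eval a).map_eq_gaussianReal, hWmean, hvar]) hF
    (by simpa only [Real.coe_toNNReal _ (hev _), hsumsq] using hv) t
  simp only [Real.coe_toNNReal _ (hev _), Finset.sum_sub_distrib, hsq, htr] at hmain
  simpa only [Finset.sum_sub_distrib] using hmain

end Gaussian

/-! ### Decay of the covariance of two increments. -/

/-- Iterated differences of a holomorphic function: each step costs a Cauchy estimate on a disc of
radius `r`. -/
lemma norm_fwdDiff_iter_le_of_differentiableOn {r : ℝ} (hr : 0 < r) (k : ℕ) :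
    ∀ {f : ℂ → ℂ} {R C : ℝ}, DifferentiableOn ℂ f (Metric.ball 0 R) →
      (∀ z ∈ Metric.ball (0 : ℂ) R, ‖f z‖ ≤ C) →
      ∀ z : ℂ, ‖z‖ + k * (1 + r) < R → ‖(fwdDiff (1 : ℂ))^[k] f z‖ ≤ C / r ^ k := by
  induction k with
  | zero =>
    intro f R C _ hC z hz
    simpa using hC z (by simpa using hz)
  | succ k ih =>
    intro f R C hf hC z hz
    rw [Function.iterate_succ_apply, pow_succ', ← div_div]
    have hsub : Metric.ball (0 : ℂ) (R - (1 + r)) ⊆ Metric.ball 0 R :=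
      Metric.ball_subset_ball (by linarith)
    have hsub' : ∀ z ∈ Metric.ball (0 : ℂ) (R - (1 + r)), z + 1 ∈ Metric.ball (0 : ℂ) R := by
      intro z hz
      rw [mem_ball_zero_iff] at hz ⊢
      have := norm_add_le z 1
      rw [norm_one] at this
      linarith
    -- The induction is applied to the first difference. It lives on a disc smaller by $1+r$ ($1$
    -- for the shift, $r$ for the Cauchy discs) and is at most $C/r$ by the mean value inequality
    -- over a unit step.
    refine ih (f := fwdDiff (1 : ℂ) f) (R := R - (1 + r)) ?_ ?_ z (by push_cast at hz; linarith)
    · refine DifferentiableOn.sub ?_ (hf.mono hsub)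
      exact hf.comp (by fun_prop) hsub'
    · intro w hw
      have hd : ∀ y ∈ Metric.ball (0 : ℂ) (R - r), ‖deriv f y‖ ≤ C / r := by
        intro y hy
        have hcl : Metric.closedBall y r ⊆ Metric.ball 0 R := by
          intro x hx
          rw [mem_ball_zero_iff] at hy ⊢
          rw [mem_closedBall_iff_norm] at hx
          have := norm_add_le (x - y) y
          rw [sub_add_cancel] at this
          linarith
        refine Complex.norm_deriv_le_of_forall_mem_sphere_norm_le hr ?_ fun x hx =>
          hC x (hcl (Metric.sphere_subset_closedBall hx))
        exact (hf.mono hcl).diffContOnCl_ball subset_rfl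
      rw [mem_ball_zero_iff] at hw
      have h1 : w ∈ Metric.ball (0 : ℂ) (R - r) := by rw [mem_ball_zero_iff]; linarith
      have h2 : w + 1 ∈ Metric.ball (0 : ℂ) (R - r) := by
        rw [mem_ball_zero_iff]
        have := norm_add_le w 1
        rw [norm_one] at this
        linarith
      have h3 := (convex_ball (0 : ℂ) (R - r)).norm_image_sub_le_of_norm_deriv_le (f := f)
        (fun y hy => (hf.differentiableAt (Metric.isOpen_ball.mem_nhds
          (Metric.ball_subset_ball (by linarith) hy)))) hd h1 h2
      simpa [fwdDiff] using h3

lemma norm_exp_sub_one_le_mul_exp (w : ℂ) : ‖Complex.exp w - 1‖ ≤ ‖w‖ * Real.exp ‖w‖ := by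
  simpa using Complex.norm_exp_sub_sum_le_norm_mul_exp w 1

section Line

variable {E : Type*} [NormedAddCommGroup E] [InnerProductSpace ℝ E]

/-- The holomorphic continuation of `t ↦ ‖a + t b‖²`. -/
def complexNormSq (a b : E) (z : ℂ) : ℂ :=
  ((‖a‖ ^ 2 : ℝ) : ℂ) + ((2 * inner ℝ a b : ℝ) : ℂ) * z + ((‖b‖ ^ 2 : ℝ) : ℂ) * z ^ 2

lemma complexNormSq_ofReal (a b : E) (t : ℝ) :
    complexNormSq a b t = ((‖a + t • b‖ ^ 2 : ℝ) : ℂ) := by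
  rw [complexNormSq, norm_add_sq_real, real_inner_smul_right, norm_smul, mul_pow, Real.norm_eq_abs,
    sq_abs]
  push_cast; ring

/-- The linear term is at most $\tfrac25\|a\|^2$ and the quadratic one at most $\tfrac1{25}\|a\|^2$.
So the continuation stays in the right half plane, where the principal power is holomorphic. -/
lemma norm_complexNormSq_sub_le {a b : E} {z : ℂ} (hz : 5 * (‖z‖ * ‖b‖) ≤ ‖a‖) :
    ‖complexNormSq a b z - ((‖a‖ ^ 2 : ℝ) : ℂ)‖ ≤ ‖a‖ ^ 2 / 2 := by
  have h1 : complexNormSq a b z - ((‖a‖ ^ 2 : ℝ) : ℂ) =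
      ((2 * inner ℝ a b : ℝ) : ℂ) * z + ((‖b‖ ^ 2 : ℝ) : ℂ) * z ^ 2 := by
    rw [complexNormSq]; ring
  rw [h1]
  refine (norm_add_le _ _).trans ?_
  rw [norm_mul, norm_mul, norm_pow, Complex.norm_real, Complex.norm_real, Real.norm_eq_abs,
    Real.norm_eq_abs, abs_mul, abs_two, abs_of_nonneg (sq_nonneg ‖b‖)]
  have h2 := abs_real_inner_le_norm a b
  have h3 : 0 ≤ ‖z‖ * ‖b‖ := by positivity
  have h4 := norm_nonneg a
  have h5 : 2 * |inner ℝ a b| * ‖z‖ ≤ 2 * (‖a‖ * ‖b‖) * ‖z‖ := by gcongr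
  nlinarith [mul_nonneg h4 h3]

/-- The iterated differences of `t ↦ exp (-‖a + t b‖^δ)` far away from the origin. -/
lemma abs_fwdDiff_exp_neg_norm_rpow_le {δ : ℝ} (hδ0 : 0 < δ) (hδ2 : δ < 2) {m : ℕ} (hm : 1 ≤ m)
    {a b : E} (hb : b ≠ 0) (hab : 30 * m * ‖b‖ < ‖a‖) :
    |(fwdDiff (1 : ℝ))^[2 * m] (fun t => Real.exp (-(‖a + t • b‖ ^ δ))) (-m)| ≤
      2 * ‖a‖ ^ δ * Real.exp (2 * ‖a‖ ^ δ) * (20 * m * ‖b‖ / ‖a‖) ^ (2 * m) := by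
  have hb' : 0 < ‖b‖ := norm_pos_iff.2 hb
  have hm' : (1 : ℝ) ≤ m := by exact_mod_cast hm
  have ha' : 0 < ‖a‖ := lt_of_le_of_lt (by positivity) hab
  set ρ : ℝ := ‖a‖ / (5 * ‖b‖) with hρ
  have hρ6 : 6 * m < ρ := by rw [hρ, lt_div_iff₀ (by positivity)]; linarith
  set g : ℂ → ℂ := fun z => Complex.exp (-(complexNormSq a b z) ^ ((δ / 2 : ℝ) : ℂ)) with hg
  have hz : ∀ z ∈ Metric.ball (0 : ℂ) ρ, 5 * (‖z‖ * ‖b‖) ≤ ‖a‖ := by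
    intro z hz
    rw [mem_ball_zero_iff, hρ, lt_div_iff₀ (by positivity)] at hz
    linarith
  have hslit : ∀ z ∈ Metric.ball (0 : ℂ) ρ, complexNormSq a b z ∈ Complex.slitPlane := by
    intro z hz1
    left
    have h1 := (Complex.abs_re_le_norm _).trans (norm_complexNormSq_sub_le (hz z hz1))
    rw [Complex.sub_re, Complex.ofReal_re] at h1
    nlinarith [(abs_le.1 h1).1, sq_pos_of_pos ha']
  have hnorm : ∀ z ∈ Metric.ball (0 : ℂ) ρ,
      ‖-(complexNormSq a b z) ^ ((δ / 2 : ℝ) : ℂ)‖ ≤ 2 * ‖a‖ ^ δ := by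
    intro z hz1
    rw [norm_neg, Complex.norm_cpow_real]
    have h1 := norm_complexNormSq_sub_le (hz z hz1)
    have h2 : ‖complexNormSq a b z‖ ≤ 2 * ‖a‖ ^ 2 := by
      have := norm_add_le (complexNormSq a b z - ((‖a‖ ^ 2 : ℝ) : ℂ)) ((‖a‖ ^ 2 : ℝ) : ℂ)
      rw [sub_add_cancel, Complex.norm_real, Real.norm_eq_abs, abs_of_nonneg (sq_nonneg _)] at this
      nlinarith [sq_nonneg ‖a‖]
    calc ‖complexNormSq a b z‖ ^ (δ / 2) ≤ (2 * ‖a‖ ^ 2) ^ (δ / 2) := by gcongr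
      _ = 2 ^ (δ / 2) * ‖a‖ ^ δ := by
          rw [Real.mul_rpow (by norm_num) (by positivity), ← Real.rpow_natCast,
            ← Real.rpow_mul ha'.le]
          congr 2; push_cast; ring
      _ ≤ 2 ^ (1 : ℝ) * ‖a‖ ^ δ := by gcongr <;> linarith
      _ = 2 * ‖a‖ ^ δ := by rw [Real.rpow_one]
  -- Subtracting $1$ does not change differences of positive order, but gives a bound proportional
  -- to $\|a\|^\delta$.
  have hdiff : DifferentiableOn ℂ (fun z => g z - 1) (Metric.ball 0 ρ) := by
    have hq : Differentiable ℂ (complexNormSq a b) := by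
      unfold complexNormSq; fun_prop
    intro z hz1
    refine DifferentiableAt.differentiableWithinAt ?_
    refine DifferentiableAt.sub_const ?_ _
    exact ((hq z).cpow_const (hslit z hz1)).neg.cexp
  have hbound : ∀ z ∈ Metric.ball (0 : ℂ) ρ, ‖g z - 1‖ ≤ 2 * ‖a‖ ^ δ * Real.exp (2 * ‖a‖ ^ δ) := by
    intro z hz1
    refine (norm_exp_sub_one_le_mul_exp _).trans ?_
    have := hnorm z hz1
    gcongr
  -- With $r=\rho/(4m)$, starting at $-m$ and taking $2m$ steps needs $3m+\rho/2<\rho$, that is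
  -- $\rho>6m$. This is where the factor $30$ in the hypothesis comes from.
  have hr : 0 < ρ / (4 * m) := by positivity
  have hmain := norm_fwdDiff_iter_le_of_differentiableOn hr (2 * m) hdiff hbound (-(m : ℂ)) (by
    rw [norm_neg, Complex.norm_natCast]
    push_cast
    have : 2 * (m : ℝ) * (ρ / (4 * m)) = ρ / 2 := by field_simp; ring
    rw [mul_add, this]
    linarith)
  have hgt : ∀ t : ℝ, g t = (Real.exp (-(‖a + t • b‖ ^ δ)) : ℝ) := by
    intro t
    simp only [hg]
    rw [complexNormSq_ofReal, ← Complex.ofReal_cpow (by positivity), ← Real.rpow_natCast,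
      ← Real.rpow_mul (norm_nonneg _)]
    push_cast
    congr 4; ring
  have hreal : (fwdDiff (1 : ℂ))^[2 * m] (fun z => g z - 1) (-(m : ℂ)) =
      (((fwdDiff (1 : ℝ))^[2 * m] (fun t => Real.exp (-(‖a + t • b‖ ^ δ))) (-m) : ℝ) : ℂ) := by
    have h1 : (fwdDiff (1 : ℝ))^[2 * m] (fun t => Real.exp (-(‖a + t • b‖ ^ δ))) (-m) =
        (fwdDiff (1 : ℝ))^[2 * m] (fun t => Real.exp (-(‖a + t • b‖ ^ δ)) - 1) (-m) := by
      obtain ⟨k, hk⟩ : ∃ k, 2 * m = k + 1 := ⟨2 * m - 1, by omega⟩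
      have e : fwdDiff (1 : ℝ) (fun t : ℝ => Real.exp (-(‖a + t • b‖ ^ δ))) =
          fwdDiff (1 : ℝ) (fun t : ℝ => Real.exp (-(‖a + t • b‖ ^ δ)) - 1) := by
        funext t
        simp [fwdDiff]
      rw [hk, Function.iterate_succ_apply, Function.iterate_succ_apply, e]
    rw [h1, fwdDiff_iter_eq_sum_shift, fwdDiff_iter_eq_sum_shift, Complex.ofReal_sum]
    refine Finset.sum_congr rfl fun k _ => ?_
    have h2 : -(m : ℂ) + k • (1 : ℂ) = ((-(m : ℝ) + k • (1 : ℝ) : ℝ) : ℂ) := by simp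
    rw [h2, hgt]
    simp
  rw [hreal, Complex.norm_real, Real.norm_eq_abs] at hmain
  refine hmain.trans (le_of_eq ?_)
  rw [div_eq_mul_inv, ← inv_pow]
  congr 2
  rw [hρ]; field_simp; norm_num

/-- The double alternating sum of the values `exp (-‖a + (i - j) b‖^δ)`, i.e. the covariance of two
increments of order `m` in the direction `b` with lag `a`. -/
def incrementCov (δ : ℝ) (m : ℕ) (a b : E) : ℝ :=
  ∑ i ∈ Finset.range (m + 1), ∑ j ∈ Finset.range (m + 1),
    altBinom m i * altBinom m j * Real.exp (-(‖a + ((i : ℝ) - j) • b‖ ^ δ))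

lemma sum_abs_altBinom (m : ℕ) : ∑ i ∈ Finset.range (m + 1), |altBinom m i| = 2 ^ m := by
  have h2 := Nat.sum_range_choose m
  rw [← Nat.cast_two, ← Nat.cast_pow, ← h2, Nat.cast_sum]
  refine Finset.sum_congr rfl fun i _ => ?_
  simp [altBinom, abs_mul]

/-- Since the coefficients sum to zero, $1$ may be subtracted from each exponential. Then
$|e^{-x}-1|\le x$ for $x\ge0$, and the absolute coefficients sum to $2^m\cdot2^m$. -/
lemma abs_incrementCov_le_near {δ : ℝ} (hδ0 : 0 < δ) {m : ℕ} (hm : 1 ≤ m) (a b : E) :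
    |incrementCov δ m a b| ≤ 4 ^ m * (‖a‖ + m * ‖b‖) ^ δ := by
  have h0 : ∑ i ∈ Finset.range (m + 1), ∑ j ∈ Finset.range (m + 1),
      altBinom m i * altBinom m j = 0 := by
    simp_rw [← Finset.mul_sum, sum_altBinom hm, mul_zero, Finset.sum_const_zero]
  have h1 : incrementCov δ m a b = ∑ i ∈ Finset.range (m + 1), ∑ j ∈ Finset.range (m + 1),
      altBinom m i * altBinom m j * (Real.exp (-(‖a + ((i : ℝ) - j) • b‖ ^ δ)) - 1) := by
    rw [incrementCov, ← sub_zero (∑ i ∈ _, _), ← h0, ← Finset.sum_sub_distrib]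
    refine Finset.sum_congr rfl fun i _ => ?_
    rw [← Finset.sum_sub_distrib]
    exact Finset.sum_congr rfl fun j _ => by ring
  rw [h1]
  have h4 : (4 : ℝ) ^ m = 2 ^ m * 2 ^ m := by rw [← mul_pow]; norm_num
  rw [h4, ← sum_abs_altBinom, Finset.sum_mul_sum, Finset.sum_mul]
  refine (Finset.abs_sum_le_sum_abs _ _).trans (Finset.sum_le_sum fun i hi => ?_)
  rw [Finset.sum_mul]
  refine (Finset.abs_sum_le_sum_abs _ _).trans (Finset.sum_le_sum fun j hj => ?_)
  rw [abs_mul, abs_mul]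
  refine mul_le_mul_of_nonneg_left ?_ (by positivity)
  have hij : |(i : ℝ) - j| ≤ m := by
    have hi' : (i : ℝ) ≤ m := by exact_mod_cast Nat.lt_succ_iff.1 (Finset.mem_range.1 hi)
    have hj' : (j : ℝ) ≤ m := by exact_mod_cast Nat.lt_succ_iff.1 (Finset.mem_range.1 hj)
    rw [abs_le]; constructor <;> linarith [Nat.cast_nonneg (α := ℝ) i, Nat.cast_nonneg (α := ℝ) j]
  have h5 : ‖a + ((i : ℝ) - j) • b‖ ≤ ‖a‖ + m * ‖b‖ := by
    refine (norm_add_le _ _).trans ?_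
    rw [norm_smul, Real.norm_eq_abs]; gcongr
  have h6 : 0 ≤ ‖a + ((i : ℝ) - j) • b‖ ^ δ := by positivity
  rw [abs_sub_comm, abs_of_nonneg (by rw [sub_nonneg]; exact Real.exp_le_one_iff.2 (by linarith))]
  have h7 := Real.add_one_le_exp (-(‖a + ((i : ℝ) - j) • b‖ ^ δ))
  have h8 : ‖a + ((i : ℝ) - j) • b‖ ^ δ ≤ (‖a‖ + m * ‖b‖) ^ δ := by gcongr
  linarith

lemma abs_incrementCov_eq (δ : ℝ) (m : ℕ) (a b : E) :
    |incrementCov δ m a b| =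
      |(fwdDiff (1 : ℝ))^[2 * m] (fun t => Real.exp (-(‖a + t • b‖ ^ δ))) (-m)| := by
  have h1 := sum_sum_altBinom (1 : ℝ) (fun t => Real.exp (-(‖a + t • b‖ ^ δ))) m 0
  simp only [zero_add, zero_sub, zsmul_eq_mul, mul_one, nsmul_eq_mul, Int.cast_sub,
    Int.cast_natCast] at h1
  rw [incrementCov, h1, abs_mul]; simp

/-- Decay of the covariance of two increments. -/
lemma exists_abs_incrementCov_le {δ : ℝ} (hδ0 : 0 < δ) (hδ2 : δ < 2) {m : ℕ} (hm : 1 ≤ m)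
    (R : ℝ) : ∃ C : ℝ, 0 < C ∧ ∀ a b : E, b ≠ 0 → ‖a‖ ≤ R →
      |incrementCov δ m a b| ≤ C * ‖b‖ ^ δ * (1 + ‖a‖ / ‖b‖) ^ (δ - 2 * m) := by
  have hm' : (1 : ℝ) ≤ m := by exact_mod_cast hm
  set C₁ : ℝ := 4 ^ m * (31 * m) ^ δ * (1 + 30 * m) ^ (2 * m - δ) with hC₁
  set C₂ : ℝ := 2 * Real.exp (2 * |R| ^ δ) * (20 * m) ^ (2 * m) * 2 ^ (2 * m - δ) with hC₂
  have hC₁0 : 0 < C₁ := by positivity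
  have hC₂0 : 0 < C₂ := by positivity
  refine ⟨C₁ + C₂, by positivity, fun a b hb ha => ?_⟩
  have hb' : 0 < ‖b‖ := norm_pos_iff.2 hb
  have hs0 : 0 ≤ ‖a‖ / ‖b‖ := by positivity
  set s := ‖a‖ / ‖b‖ with hs
  have has : ‖a‖ = s * ‖b‖ := by rw [hs]; field_simp
  -- For lags comparable to the step the crude bound suffices, as $1+s$ is bounded. For longer lags
  -- the Cauchy bound gives the decay, and $\|a\|\le R$ keeps its exponential factor bounded.
  rcases le_or_gt ‖a‖ (30 * m * ‖b‖) with hab | hab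
  · have hs30 : s ≤ 30 * m := by rw [hs, div_le_iff₀ hb']; exact hab
    calc |incrementCov δ m a b| ≤ 4 ^ m * (‖a‖ + m * ‖b‖) ^ δ := abs_incrementCov_le_near hδ0 hm a b
      _ ≤ 4 ^ m * (31 * m * ‖b‖) ^ δ := by gcongr; linarith
      _ = 4 ^ m * (31 * m) ^ δ * ‖b‖ ^ δ * 1 := by
          rw [Real.mul_rpow (by positivity) hb'.le]; ring
      _ ≤ 4 ^ m * (31 * m) ^ δ * ‖b‖ ^ δ *
            ((1 + 30 * m) ^ (2 * m - δ) * (1 + s) ^ (δ - 2 * m)) := by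
          gcongr
          have e : δ - 2 * m = -(2 * m - δ) := by ring
          rw [e, Real.rpow_neg (by positivity), ← div_eq_mul_inv, one_le_div (by positivity)]
          gcongr
          linarith
      _ = C₁ * ‖b‖ ^ δ * (1 + s) ^ (δ - 2 * m) := by rw [hC₁]; ring
      _ ≤ (C₁ + C₂) * ‖b‖ ^ δ * (1 + s) ^ (δ - 2 * m) := by gcongr; linarith
  · have hs30 : 30 * m < s := by rw [hs, lt_div_iff₀ hb']; exact hab
    have hspos : 0 < s := by linarith
    rw [abs_incrementCov_eq]
    have haR : ‖a‖ ^ δ ≤ |R| ^ δ := by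
      have := ha.trans (le_abs_self R)
      gcongr
    calc _ ≤ 2 * ‖a‖ ^ δ * Real.exp (2 * ‖a‖ ^ δ) * (20 * m * ‖b‖ / ‖a‖) ^ (2 * m) :=
          abs_fwdDiff_exp_neg_norm_rpow_le hδ0 hδ2 hm hb hab
      _ ≤ 2 * ‖a‖ ^ δ * Real.exp (2 * |R| ^ δ) * (20 * m * ‖b‖ / ‖a‖) ^ (2 * m) := by gcongr
      _ = 2 * Real.exp (2 * |R| ^ δ) * (20 * m) ^ (2 * m) * ‖b‖ ^ δ * s ^ (δ - 2 * m) := by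
          have e1 : 20 * m * ‖b‖ / ‖a‖ = 20 * m / s := by rw [has]; field_simp
          have e2 : s ^ (δ - 2 * m) = s ^ δ / s ^ (2 * m) := by
            rw [Real.rpow_sub hspos, ← Real.rpow_natCast s (2 * m)]; push_cast; rfl
          rw [e1, e2, has, Real.mul_rpow hs0 hb'.le, div_pow]
          ring
      _ ≤ 2 * Real.exp (2 * |R| ^ δ) * (20 * m) ^ (2 * m) * ‖b‖ ^ δ *
            (2 ^ (2 * m - δ) * (1 + s) ^ (δ - 2 * m)) := by
          gcongr
          have e : δ - 2 * m = -(2 * m - δ) := by ring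
          rw [e, Real.rpow_neg hs0, Real.rpow_neg (by positivity), ← div_eq_mul_inv,
            inv_eq_one_div, div_le_div_iff₀ (by positivity) (by positivity), one_mul,
            ← Real.mul_rpow (by norm_num) hs0]
          apply Real.rpow_le_rpow (by positivity) <;> linarith
      _ = C₂ * ‖b‖ ^ δ * (1 + s) ^ (δ - 2 * m) := by rw [hC₂]; ring
      _ ≤ (C₁ + C₂) * ‖b‖ ^ δ * (1 + s) ^ (δ - 2 * m) := by gcongr; linarith

end Line

/-! ### Counting and summing over the grid. -/

section Lattice

variable {d : ℕ}

/-- The point of `ℤᵈ / n` with numerators `z`. -/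
def gridPoint (n : ℕ) (z : Fin d → ℤ) : EuclideanSpace ℝ (Fin d) :=
  WithLp.toLp 2 fun i => (z i : ℝ) / n

lemma gridPoint_injective {n : ℕ} (hn : n ≠ 0) : Function.Injective (gridPoint (d := d) n) := by
  intro z w h
  funext i
  have h1 : gridPoint n z i = gridPoint n w i := by rw [h]
  have hn' : (n : ℝ) ≠ 0 := by exact_mod_cast hn
  simp only [gridPoint] at h1
  field_simp at h1
  exact_mod_cast h1

lemma mem_grid_iff {Ω : Set (EuclideanSpace ℝ (Fin d))} {n : ℕ} {t : EuclideanSpace ℝ (Fin d)} :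
    t ∈ grid Ω n ↔ t ∈ Ω ∧ ∃ z, gridPoint n z = t := by
  refine and_congr_right fun _ => exists_congr fun z => ⟨fun h => ?_, fun h i => ?_⟩
  · ext i; exact (h i).symm
  · rw [← h]; rfl

lemma abs_coord_le_of_norm_gridPoint_le {n : ℕ} (hn : n ≠ 0) {z : Fin d → ℤ} {K : ℕ}
    (h : n * ‖gridPoint n z‖ ≤ K) (i : Fin d) : z i ∈ Finset.Icc (-(K : ℤ)) K := by
  have hn' : (0 : ℝ) < n := by positivity
  have h1 := PiLp.norm_apply_le (gridPoint n z) i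
  have h2 : ‖gridPoint n z i‖ = |(z i : ℝ)| / n := by
    simp [gridPoint]
  rw [h2, div_le_iff₀ hn'] at h1
  have h3 : |(z i : ℝ)| ≤ K := by linarith
  rw [Finset.mem_Icc, ← abs_le]
  exact_mod_cast h3

lemma grid_finite {Ω : Set (EuclideanSpace ℝ (Fin d))} (hΩb : Bornology.IsBounded Ω) {n : ℕ}
    (hn : n ≠ 0) : (grid Ω n).Finite := by
  obtain ⟨R, hR⟩ := hΩb.exists_norm_le
  refine ((Fintype.piFinset fun _ : Fin d =>
    Finset.Icc (-(⌈n * R⌉₊ : ℤ)) ⌈n * R⌉₊).finite_toSet.image (gridPoint n)).subset ?_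
  intro t ht
  obtain ⟨h1, z, rfl⟩ := mem_grid_iff.1 ht
  refine ⟨z, ?_, rfl⟩
  simp only [Finset.mem_coe, Fintype.mem_piFinset]
  refine abs_coord_le_of_norm_gridPoint_le hn (le_trans ?_ (Nat.le_ceil _))
  have := hR _ h1
  gcongr

/-- In the sup norm a ball inside $\Omega$ is a cube. It contains $K^d$ grid points with $K=\lfloor
nr/2\rfloor$, and $K\ge nr/4$ once $nr\ge4$. -/
lemma exists_le_ncard_grid {Ω : Set (EuclideanSpace ℝ (Fin d))} (hΩo : IsOpen Ω)
    (hΩb : Bornology.IsBounded Ω) (hΩn : Ω.Nonempty) :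
    ∃ c : ℝ, 0 < c ∧ ∀ᶠ n : ℕ in atTop, c * (n : ℝ) ^ d ≤ (grid Ω n).ncard := by
  obtain ⟨x, hx⟩ := hΩn
  have ho : IsOpen ((fun v : Fin d → ℝ => WithLp.toLp 2 v) ⁻¹' Ω) :=
    hΩo.preimage (PiLp.continuous_toLp 2 _)
  obtain ⟨r, hr, hball⟩ := Metric.isOpen_iff.1 ho (WithLp.ofLp x) (by simpa using hx)
  refine ⟨(r / 4) ^ d, by positivity, ?_⟩
  filter_upwards [eventually_gt_atTop 0, eventually_ge_atTop ⌈4 / r⌉₊] with n hn hnr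
  have hn' : (0 : ℝ) < n := by exact_mod_cast hn
  have hnr' : 1 ≤ n * (r / 4) := by
    have := (Nat.le_ceil (4 / r)).trans (Nat.cast_le.2 hnr)
    rw [div_le_iff₀ hr] at this
    linarith
  set K := ⌊n * (r / 2)⌋₊ with hK
  have hK1 : (K : ℝ) ≤ n * (r / 2) := Nat.floor_le (by positivity)
  have hK2 : n * (r / 4) ≤ K := by
    have := (Nat.lt_floor_add_one (n * (r / 2))).le
    rw [← hK] at this
    linarith
  set φ : (Fin d → Fin K) → Fin d → ℤ := fun k i => ⌈n * x i⌉ + (k i : ℕ) with hφ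
  have hφi : Function.Injective φ := by
    intro k l h
    funext i
    have := congrFun h i
    simp only [hφ, add_right_inj, Nat.cast_inj] at this
    exact Fin.ext this
  have hsub : Set.range (gridPoint n ∘ φ) ⊆ grid Ω n := by
    rintro _ ⟨k, rfl⟩
    refine mem_grid_iff.2 ⟨hball ?_, _, rfl⟩
    rw [Metric.mem_ball, dist_pi_lt_iff hr]
    intro i
    have h1 := Int.le_ceil (n * x i)
    have h2 := Int.ceil_lt_add_one (n * x i)
    have h3 : ((k i : ℕ) : ℝ) + 1 ≤ K := by exact_mod_cast (k i).2
    simp only [hφ]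
    rw [Real.dist_eq, abs_lt]
    push_cast
    constructor
    · rw [neg_lt_sub_iff_lt_add, ← sub_lt_iff_lt_add', lt_div_iff₀ hn']
      nlinarith [Nat.cast_nonneg (α := ℝ) (k i : ℕ)]
    · rw [sub_lt_iff_lt_add, div_lt_iff₀ hn']
      nlinarith
  have hcard := Set.ncard_le_ncard hsub (grid_finite hΩb hn.ne')
  rw [← Set.image_univ, Set.ncard_image_of_injective _ ((gridPoint_injective hn.ne').comp hφi),
    Set.ncard_univ, Nat.card_eq_fintype_card, Fintype.card_fun, Fintype.card_fin,
    Fintype.card_fin] at hcard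
  calc (r / 4) ^ d * (n : ℝ) ^ d = (n * (r / 4)) ^ d := by rw [← mul_pow]; ring
    _ ≤ (K : ℝ) ^ d := by gcongr
    _ ≤ _ := by exact_mod_cast hcard

/-- Induction on $K$. The increment of $x\mapsto x^{1-s}/(1-s)$ dominates the new term by
Bernoulli's inequality for exponents in $[0,1]$. -/
lemma sum_range_one_add_rpow_neg_le {s : ℝ} (hs0 : 0 ≤ s) (hs1 : s < 1) (K : ℕ) :
    ∑ a ∈ Finset.range K, (1 + (a : ℝ)) ^ (-s) ≤ (K : ℝ) ^ (1 - s) / (1 - s) := by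
  have h1s : 0 < 1 - s := by linarith
  induction K with
  | zero => simp [Real.zero_rpow h1s.ne']
  | succ K ih =>
    rw [Finset.sum_range_succ]
    have hx : (0 : ℝ) < K + 1 := by positivity
    have hB := rpow_one_add_le_one_add_mul_self (s := -1 / (K + 1 : ℝ)) (p := 1 - s) (by
      rw [le_div_iff₀ hx]; linarith [Nat.cast_nonneg (α := ℝ) K]) h1s.le (by linarith)
    have h2 : (K : ℝ) ^ (1 - s) = (K + 1 : ℝ) ^ (1 - s) * (1 + -1 / (K + 1 : ℝ)) ^ (1 - s) := by
      rw [← Real.mul_rpow hx.le]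
      · congr 1; field_simp; ring
      · rw [← sub_nonneg]
        have : 1 + -1 / (K + 1 : ℝ) = K / (K + 1) := by field_simp; ring
        rw [sub_zero, this]; positivity
    have h3 : (K + 1 : ℝ) ^ (-s) = (K + 1 : ℝ) ^ (1 - s) / (K + 1) := by
      rw [← Real.rpow_sub_one hx.ne']; congr 1; ring
    have h4 : 0 < (K + 1 : ℝ) ^ (1 - s) := by positivity
    rw [add_comm 1 (K : ℝ), h3]
    push_cast
    have h5 : (K : ℝ) ^ (1 - s) ≤
        (K + 1 : ℝ) ^ (1 - s) * (1 + (1 - s) * (-1 / (K + 1 : ℝ))) := by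
      rw [h2]; gcongr
    calc _ ≤ (K : ℝ) ^ (1 - s) / (1 - s) + (K + 1 : ℝ) ^ (1 - s) / (K + 1) := by gcongr
      _ ≤ (K + 1 : ℝ) ^ (1 - s) * (1 + (1 - s) * (-1 / (K + 1 : ℝ))) / (1 - s) +
          (K + 1 : ℝ) ^ (1 - s) / (K + 1) := by gcongr
      _ = _ := by field_simp; ring

lemma sum_Icc_one_add_abs_rpow_neg_le {s : ℝ} (hs0 : 0 ≤ s) (hs1 : s < 1) (K : ℕ) :
    ∑ a ∈ Finset.Icc (-(K : ℤ)) K, (1 + |(a : ℝ)|) ^ (-s) ≤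
      2 * (((K + 1 : ℕ) : ℝ) ^ (1 - s) / (1 - s)) := by
  have hsub : Finset.Icc (-(K : ℤ)) K ⊆ (Finset.range (K + 1)).image (fun a : ℕ => (a : ℤ)) ∪
      (Finset.range (K + 1)).image (fun a : ℕ => -(a : ℤ)) := by
    intro a ha
    rw [Finset.mem_Icc] at ha
    simp only [Finset.mem_union, Finset.mem_image, Finset.mem_range]
    rcases Int.natAbs_eq a with h | h
    · left; exact ⟨a.natAbs, by omega, h.symm⟩
    · right; exact ⟨a.natAbs, by omega, h.symm⟩
  have hnn : ∀ a : ℤ, 0 ≤ (1 + |(a : ℝ)|) ^ (-s) := fun a => by positivity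
  refine (Finset.sum_le_sum_of_subset_of_nonneg hsub fun a _ _ => hnn a).trans ?_
  have h1 := Finset.sum_union_inter (s₁ := (Finset.range (K + 1)).image (fun a : ℕ => (a : ℤ)))
    (s₂ := (Finset.range (K + 1)).image (fun a : ℕ => -(a : ℤ)))
    (f := fun a : ℤ => (1 + |(a : ℝ)|) ^ (-s))
  have h2 : 0 ≤ ∑ a ∈ (Finset.range (K + 1)).image (fun a : ℕ => (a : ℤ)) ∩
      (Finset.range (K + 1)).image (fun a : ℕ => -(a : ℤ)), (1 + |(a : ℝ)|) ^ (-s) :=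
    Finset.sum_nonneg fun a _ => hnn a
  have h3 := sum_range_one_add_rpow_neg_le hs0 hs1 (K + 1)
  rw [Finset.sum_image (fun a _ b _ h => by simpa using h),
    Finset.sum_image (fun a _ b _ h => by simpa using h)] at h1
  simp only [Int.cast_natCast, Int.cast_neg, abs_neg, Nat.abs_cast] at h1
  linarith

/-- Each coordinate is bounded by the Euclidean norm, so $(1+n\|\cdot\|)^{-\gamma}$ is at most a
product of $d$ one-dimensional factors with exponent $\gamma/d<1$. The sum over a box of differences
then factorises. -/
lemma sum_grid_rpow_neg_le {Ω : Set (EuclideanSpace ℝ (Fin d))}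
    (hΩb : Bornology.IsBounded Ω) (hd : 0 < d) {γ : ℝ} (hγ0 : 0 < γ) (hγd : γ < d) :
    ∃ C : ℝ, 0 < C ∧ ∀ (n : ℕ) (hn : n ≠ 0), ∀ j ∈ grid Ω n,
      ∑ k ∈ (grid_finite hΩb hn).toFinset, (1 + n * ‖j - k‖) ^ (-γ) ≤ C * (n : ℝ) ^ (d - γ) := by
  obtain ⟨R, hR0, hR⟩ := hΩb.exists_pos_norm_le
  have hd' : (0 : ℝ) < d := by exact_mod_cast hd
  set s := γ / d with hs
  have hs0 : 0 < s := by positivity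
  have hs1 : s < 1 := by rw [hs, div_lt_one hd']; exact hγd
  have h1s : 0 < 1 - s := by linarith
  set A : ℝ := 2 * ((2 * R + 2) ^ (1 - s) / (1 - s)) with hA
  have hA0 : 0 < A := by positivity
  refine ⟨A ^ d, by positivity, fun n hn j hj => ?_⟩
  have hn' : (1 : ℝ) ≤ n := by exact_mod_cast Nat.one_le_iff_ne_zero.2 hn
  set K := ⌈n * (2 * R)⌉₊ with hK
  obtain ⟨hjΩ, zj, rfl⟩ := mem_grid_iff.1 hj
  set box := Fintype.piFinset fun _ : Fin d => Finset.Icc (-(K : ℤ)) K with hbox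
  have hsub : (grid_finite hΩb hn).toFinset ⊆ box.image fun l => gridPoint n (zj - l) := by
    intro k hk
    rw [Set.Finite.mem_toFinset] at hk
    obtain ⟨hkΩ, zk, rfl⟩ := mem_grid_iff.1 hk
    refine Finset.mem_image.2 ⟨zj - zk, ?_, by simp⟩
    rw [hbox, Fintype.mem_piFinset]
    refine abs_coord_le_of_norm_gridPoint_le hn (le_trans ?_ (Nat.le_ceil _))
    have e : gridPoint n (zj - zk) = gridPoint n zj - gridPoint n zk := by
      ext i; simp [gridPoint, sub_div]
    rw [e]
    have h1 := norm_sub_le (gridPoint n zj) (gridPoint n zk)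
    have h2 := hR _ hjΩ
    have h3 := hR _ hkΩ
    gcongr
    linarith
  have hinj : ∀ l ∈ box, ∀ l' ∈ box,
      gridPoint n (zj - l) = gridPoint n (zj - l') → l = l' := by
    intro l _ l' _ h
    simpa using gridPoint_injective hn h
  calc ∑ k ∈ (grid_finite hΩb hn).toFinset, (1 + n * ‖gridPoint n zj - k‖) ^ (-γ)
      ≤ ∑ k ∈ box.image fun l => gridPoint n (zj - l), (1 + n * ‖gridPoint n zj - k‖) ^ (-γ) :=
        Finset.sum_le_sum_of_subset_of_nonneg hsub fun k _ _ => by positivity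
    _ = ∑ l ∈ box, (1 + n * ‖gridPoint n zj - gridPoint n (zj - l)‖) ^ (-γ) :=
        Finset.sum_image hinj
    _ ≤ ∑ l ∈ box, ∏ i, (1 + |(l i : ℝ)|) ^ (-s) := by
        refine Finset.sum_le_sum fun l _ => ?_
        have e : gridPoint n zj - gridPoint n (zj - l) = gridPoint n l := by
          ext i; simp [gridPoint, sub_div]
        rw [e]
        have h1 : (1 + n * ‖gridPoint n l‖) ^ (-γ) =
            ∏ _i : Fin d, (1 + n * ‖gridPoint n l‖) ^ (-s) := by
          rw [Finset.prod_const, Finset.card_univ, Fintype.card_fin, ← Real.rpow_natCast,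
            ← Real.rpow_mul (by positivity)]
          congr 1; rw [hs]; field_simp
        rw [h1]
        refine Finset.prod_le_prod (fun i _ => by positivity) fun i _ => ?_
        refine Real.rpow_le_rpow_of_nonpos (by positivity) ?_ (by linarith)
        have h2 := PiLp.norm_apply_le (gridPoint n l) i
        have h3 : ‖gridPoint n l i‖ = |(l i : ℝ)| / n := by simp [gridPoint]
        rw [h3, div_le_iff₀ (by linarith)] at h2
        linarith
    _ = (∑ a ∈ Finset.Icc (-(K : ℤ)) K, (1 + |(a : ℝ)|) ^ (-s)) ^ d := by
        have h1 := (Finset.prod_univ_sum (fun _ : Fin d => Finset.Icc (-(K : ℤ)) K)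
          fun _ a => (1 + |(a : ℝ)|) ^ (-s)).symm
        rw [hbox, h1, Finset.prod_const, Finset.card_univ, Fintype.card_fin]
    _ ≤ (A * (n : ℝ) ^ (1 - s)) ^ d := by
        refine pow_le_pow_left₀ (Finset.sum_nonneg fun a _ => by positivity) ?_ d
        refine (sum_Icc_one_add_abs_rpow_neg_le hs0.le hs1 K).trans ?_
        have h1 : ((K + 1 : ℕ) : ℝ) ≤ (2 * R + 2) * n := by
          have := (Nat.ceil_lt_add_one (a := n * (2 * R)) (by positivity)).le
          rw [← hK] at this
          push_cast
          linarith
        calc 2 * (((K + 1 : ℕ) : ℝ) ^ (1 - s) / (1 - s))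
            ≤ 2 * (((2 * R + 2) * n) ^ (1 - s) / (1 - s)) := by gcongr
          _ = A * (n : ℝ) ^ (1 - s) := by
            rw [Real.mul_rpow (by positivity) (by positivity), hA]; ring
    _ = A ^ d * (n : ℝ) ^ (d - γ) := by
        rw [mul_pow, ← Real.rpow_natCast ((n : ℝ) ^ (1 - s)), ← Real.rpow_mul (by positivity)]
        congr 2; rw [hs]; field_simp

/-- The averaged decay of a covariance with exponent `γ < d` over the grid. -/
lemma exists_sum_sum_grid_le {Ω : Set (EuclideanSpace ℝ (Fin d))} (hΩo : IsOpen Ω)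
    (hΩb : Bornology.IsBounded Ω) (hΩn : Ω.Nonempty) (hd : 0 < d) {γ : ℝ} (hγ0 : 0 < γ)
    (hγd : γ < d) :
    ∃ C : ℝ, 0 < C ∧ ∀ᶠ n : ℕ in atTop, ∀ hn : n ≠ 0,
      ∑ j ∈ (grid_finite hΩb hn).toFinset, ∑ k ∈ (grid_finite hΩb hn).toFinset,
        (1 + n * ‖j - k‖) ^ (-γ) ≤ C * (n : ℝ) ^ (-γ) * ((grid Ω n).ncard : ℝ) ^ 2 := by
  obtain ⟨C, hC, hsum⟩ := sum_grid_rpow_neg_le hΩb hd hγ0 hγd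
  obtain ⟨c, hc, hcard⟩ := exists_le_ncard_grid hΩo hΩb hΩn
  refine ⟨C / c, by positivity, ?_⟩
  filter_upwards [hcard] with n hN hn
  have hn' : (0 : ℝ) < n := by positivity
  have hcard_eq : ((grid_finite hΩb hn).toFinset.card : ℝ) = (grid Ω n).ncard := by
    rw [Set.ncard_eq_toFinset_card _ (grid_finite hΩb hn)]
  calc _ ≤ ∑ j ∈ (grid_finite hΩb hn).toFinset, C * (n : ℝ) ^ (d - γ) :=
        Finset.sum_le_sum fun j hj => hsum n hn j (by simpa using hj)
    _ = C / c * (n : ℝ) ^ (-γ) * (grid Ω n).ncard * (c * (n : ℝ) ^ d) := by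
        rw [Finset.sum_const, nsmul_eq_mul, hcard_eq, sub_eq_add_neg, Real.rpow_add hn',
          Real.rpow_natCast]
        field_simp
    _ ≤ C / c * (n : ℝ) ^ (-γ) * (grid Ω n).ncard * (grid Ω n).ncard := by gcongr
    _ = _ := by ring

end Lattice

/-! ### Expansion of the mean of the averaged squared increments. -/

section Moments

variable {E : Type*} [NormedAddCommGroup E] [InnerProductSpace ℝ E]

lemma tendsto_exp_neg_sub_div_sq (c : ℝ) :
    Tendsto (fun τ : ℝ => (Real.exp (-(c * τ)) - 1 + c * τ) / τ ^ 2) (𝓝[>] 0)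
      (𝓝 (c ^ 2 / 2)) := by
  have hlim : Tendsto (fun τ : ℝ => |c| ^ 3 * τ) (𝓝[>] 0) (𝓝 0) := by
    have : Tendsto (fun τ : ℝ => |c| ^ 3 * τ) (𝓝 0) (𝓝 (|c| ^ 3 * 0)) :=
      (continuous_const.mul continuous_id).tendsto 0
    rw [mul_zero] at this
    exact this.mono_left nhdsWithin_le_nhds
  have hsmall : ∀ᶠ τ : ℝ in 𝓝[>] 0, |c * τ| < 1 := by
    have : Tendsto (fun τ : ℝ => |c * τ|) (𝓝 0) (𝓝 |c * 0|) :=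
      ((continuous_const.mul continuous_id).abs).tendsto 0
    rw [mul_zero, abs_zero] at this
    exact (this.eventually_lt_const one_pos).filter_mono nhdsWithin_le_nhds
  rw [tendsto_iff_norm_sub_tendsto_zero]
  refine squeeze_zero' (Eventually.of_forall fun _ => norm_nonneg _) ?_ hlim
  filter_upwards [hsmall, self_mem_nhdsWithin] with τ h1 h2
  have hτ : 0 < τ := h2
  have h3 := Real.exp_bound (x := -(c * τ)) (by rw [abs_neg]; exact h1.le) (n := 3) (by norm_num)
  have h4 : (Real.exp (-(c * τ)) - 1 + c * τ) / τ ^ 2 - c ^ 2 / 2 =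
      (Real.exp (-(c * τ)) - ∑ m ∈ Finset.range 3, (-(c * τ)) ^ m / (m.factorial : ℝ)) / τ ^ 2 := by
    simp [Finset.sum_range_succ, Nat.factorial]
    field_simp
    ring
  rw [h4, Real.norm_eq_abs, abs_div, abs_of_pos (pow_pos hτ 2), div_le_iff₀ (by positivity)]
  refine h3.trans ?_
  rw [abs_neg, abs_mul, abs_of_pos hτ]
  norm_num [Nat.factorial]
  have h5 : 0 ≤ (|c| * τ) ^ 3 := by positivity
  nlinarith

lemma incrementCov_zero {δ : ℝ} (m : ℕ) (b : E) :
    incrementCov δ m 0 b = ∑ i ∈ Finset.range (m + 1), ∑ j ∈ Finset.range (m + 1),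
      altBinom m i * altBinom m j * Real.exp (-(|(i : ℝ) - j| ^ δ * ‖b‖ ^ δ)) := by
  refine Finset.sum_congr rfl fun i _ => Finset.sum_congr rfl fun j _ => ?_
  rw [zero_add, norm_smul, Real.norm_eq_abs, Real.mul_rpow (abs_nonneg _) (norm_nonneg _)]

/-- Second order expansion of the normalised variance of an increment. -/
lemma tendsto_variance_expansion {δ : ℝ} (hδ0 : 0 < δ) {m : ℕ} (hm : 1 ≤ m) {b : E} (hb : b ≠ 0) :
    Tendsto (fun n : ℕ => (n : ℝ) ^ δ * ((n : ℝ) ^ δ * incrementCov δ m 0 ((n : ℝ)⁻¹ • b) +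
      ‖b‖ ^ δ * D m δ)) atTop (𝓝 (‖b‖ ^ (2 * δ) * D m (2 * δ) / 2)) := by
  have hb' : 0 < ‖b‖ := norm_pos_iff.2 hb
  -- The small parameter is $\tau_n=\|b/n\|^\delta$. The constant term of the expansion cancels, the
  -- linear one produces $D_{m,\delta}$ and the quadratic one $D_{m,2\delta}/2$.
  set τ : ℕ → ℝ := fun n => ‖b‖ ^ δ * (n : ℝ) ^ (-δ) with hτ
  have hτlim : Tendsto τ atTop (𝓝[>] 0) := by
    refine tendsto_nhdsWithin_iff.2 ⟨?_, ?_⟩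
    · have := ((tendsto_rpow_neg_atTop hδ0).comp
        (tendsto_natCast_atTop_atTop (R := ℝ))).const_mul (‖b‖ ^ δ)
      rw [mul_zero] at this
      exact this
    · filter_upwards [eventually_gt_atTop 0] with n hn
      have : (0 : ℝ) < n := by exact_mod_cast hn
      show 0 < τ n
      positivity
  have h1 : Tendsto (fun n => ‖b‖ ^ (2 * δ) * ∑ i ∈ Finset.range (m + 1),
      ∑ j ∈ Finset.range (m + 1), altBinom m i * altBinom m j *
        ((Real.exp (-(|(i : ℝ) - j| ^ δ * τ n)) - 1 + |(i : ℝ) - j| ^ δ * τ n) / τ n ^ 2)) atTop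
      (𝓝 (‖b‖ ^ (2 * δ) * ∑ i ∈ Finset.range (m + 1), ∑ j ∈ Finset.range (m + 1),
        altBinom m i * altBinom m j * ((|(i : ℝ) - j| ^ δ) ^ 2 / 2))) := by
    refine Tendsto.const_mul _ (tendsto_finsetSum _ fun i _ => tendsto_finsetSum _ fun j _ =>
      Tendsto.const_mul _ ?_)
    exact (tendsto_exp_neg_sub_div_sq _).comp hτlim
  have hD : ‖b‖ ^ (2 * δ) * ∑ i ∈ Finset.range (m + 1), ∑ j ∈ Finset.range (m + 1),
      altBinom m i * altBinom m j * ((|(i : ℝ) - j| ^ δ) ^ 2 / 2) =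
      ‖b‖ ^ (2 * δ) * D m (2 * δ) / 2 := by
    rw [D_eq_altBinom, mul_div_assoc, Finset.sum_div]
    congr 1
    refine Finset.sum_congr rfl fun i _ => ?_
    rw [Finset.sum_div]
    refine Finset.sum_congr rfl fun j _ => ?_
    rw [mul_comm 2 δ, Real.rpow_mul (abs_nonneg _), Real.rpow_two]; ring
  rw [hD] at h1
  refine h1.congr' ?_
  filter_upwards [eventually_gt_atTop 0] with n hn
  have hn' : (0 : ℝ) < n := by exact_mod_cast hn
  have hnorm : ‖(n : ℝ)⁻¹ • b‖ ^ δ = τ n := by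
    rw [norm_smul, norm_inv, Real.norm_natCast, Real.mul_rpow (by positivity) hb'.le,
      Real.inv_rpow hn'.le, ← Real.rpow_neg hn'.le, mul_comm]
  have hτn : 0 < τ n := by positivity
  have hτ1 : (n : ℝ) ^ δ * τ n = ‖b‖ ^ δ := by
    rw [hτ]; simp only
    rw [Real.rpow_neg hn'.le]
    field_simp
  have hb2 : ‖b‖ ^ (2 * δ) = ((n : ℝ) ^ δ) ^ 2 * τ n ^ 2 := by
    rw [← mul_pow, hτ1, mul_comm, Real.rpow_mul hb'.le, Real.rpow_two]
  have h0 : ∑ i ∈ Finset.range (m + 1), ∑ j ∈ Finset.range (m + 1),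
      altBinom m i * altBinom m j = 0 := by
    simp_rw [← Finset.mul_sum, sum_altBinom hm, mul_zero, Finset.sum_const_zero]
  have hsum : ∑ i ∈ Finset.range (m + 1), ∑ j ∈ Finset.range (m + 1), altBinom m i * altBinom m j *
        ((Real.exp (-(|(i : ℝ) - j| ^ δ * τ n)) - 1 + |(i : ℝ) - j| ^ δ * τ n) / τ n ^ 2) =
      (incrementCov δ m 0 ((n : ℝ)⁻¹ • b) + τ n * D m δ) / τ n ^ 2 := by
    rw [incrementCov_zero, hnorm, D_eq_altBinom, ← sub_zero (∑ i ∈ _, ∑ j ∈ _, _ * Real.exp _),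
      ← h0, ← Finset.sum_sub_distrib, Finset.mul_sum, ← Finset.sum_add_distrib, Finset.sum_div]
    refine Finset.sum_congr rfl fun i _ => ?_
    rw [← Finset.sum_sub_distrib, Finset.mul_sum, ← Finset.sum_add_distrib, Finset.sum_div]
    refine Finset.sum_congr rfl fun j _ => ?_
    ring
  rw [hsum, hb2, ← hτ1]
  field_simp

end Moments

/-! ### Increments of the field and the Frobenius norm of their covariance. -/

section Field

variable {d : ℕ} {S : Type*} [MeasurableSpace S] {P : Measure S}
  {Y : EuclideanSpace ℝ (Fin d) → S → ℝ} {δ σ α : ℝ} {M : Matrix (Fin d) (Fin d) ℝ}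

lemma isGaussianProcess_fwdDiff_iter (hY : IsGaussianProcess Y P) (m : ℕ)
    (u : EuclideanSpace ℝ (Fin d)) :
    IsGaussianProcess (fun j ω => (fwdDiff u)^[m] (fun t => Y t ω) j) P := by
  classical
  refine hY.of_isGaussianProcess fun j => ⟨(Finset.range (m + 1)).image fun i => j + i • u,
    (-1 : ℝ) ^ m • ∑ i : Finset.range (m + 1), altBinom m i • ContinuousLinearMap.proj
      ⟨j + (i : ℕ) • u, Finset.mem_image_of_mem _ i.2⟩, fun ω => ?_⟩
  rw [fwdDiff_iter_eq_altBinom, ← Finset.sum_coe_sort]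
  simp

lemma integral_fwdDiff_iter (hY : IsExpField P Y δ σ α M) (m : ℕ)
    (u j : EuclideanSpace ℝ (Fin d)) : ∫ ω, (fwdDiff u)^[m] (fun t => Y t ω) j ∂P = 0 := by
  simp_rw [fwdDiff_iter_eq_altBinom]
  rw [integral_const_mul, integral_finsetSum _ fun i _ =>
    ((hY.gaussian.hasGaussianLaw_eval _).integrable.const_mul _)]
  simp [integral_const_mul, hY.mean_zero]

lemma covariance_fwdDiff_iter (hY : IsExpField P Y δ σ α M) (m : ℕ)
    (u j k : EuclideanSpace ℝ (Fin d)) :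
    cov[fun ω => (fwdDiff u)^[m] (fun t => Y t ω) j, fun ω => (fwdDiff u)^[m] (fun t => Y t ω) k; P] =
      σ ^ 2 * incrementCov δ m ((α • Matrix.toEuclideanLin M) (j - k))
        ((α • Matrix.toEuclideanLin M) u) := by
  have := hY.gaussian.isProbabilityMeasure
  have hL2 : ∀ t, MemLp (Y t) 2 P := fun t => (hY.gaussian.hasGaussianLaw_eval t).memLp_two
  have hone : ((-1 : ℝ) ^ m) * (-1) ^ m = 1 := by rw [← mul_pow]; simp
  simp_rw [fwdDiff_iter_eq_altBinom]
  rw [covariance_const_mul_left, covariance_const_mul_right, ← mul_assoc, hone, one_mul,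
    covariance_fun_sum_fun_sum' (fun i _ => (hL2 _).const_mul _) (fun i _ => (hL2 _).const_mul _),
    incrementCov, Finset.mul_sum]
  refine Finset.sum_congr rfl fun i _ => ?_
  rw [Finset.mul_sum]
  refine Finset.sum_congr rfl fun i' _ => ?_
  rw [covariance_const_mul_left, covariance_const_mul_right, hY.cov_eq]
  have e : (α • Matrix.toEuclideanLin M) (j - k) + ((i : ℝ) - i') • (α • Matrix.toEuclideanLin M) u =
      α • Matrix.toEuclideanLin M (j + i • u - (k + i' • u)) := by
    rw [LinearMap.smul_apply, LinearMap.smul_apply, smul_comm _ α, ← smul_add,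
      ← (Matrix.toEuclideanLin M).map_smul, ← (Matrix.toEuclideanLin M).map_add]
    congr 2
    rw [sub_smul, Nat.cast_smul_eq_nsmul, Nat.cast_smul_eq_nsmul]; abel
  rw [e]; ring

lemma IsAnisotropy.injective (hM : IsAnisotropy M) (hα : 0 < α) :
    Function.Injective (α • Matrix.toEuclideanLin M) := by
  have hdet : IsUnit M.det := by rw [hM.det_eq_one]; exact isUnit_one
  intro x y h
  simp only [LinearMap.smul_apply] at h
  have h1 := smul_right_injective _ hα.ne' h
  rw [Matrix.toLpLin_apply, Matrix.toLpLin_apply] at h1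
  have h2 := WithLp.toLp_injective 2 h1
  have h3 := Matrix.mulVec_injective_of_isUnit ((Matrix.isUnit_iff_isUnit_det M).2 hdet) h2
  exact WithLp.ofLp_injective 2 h3

/-- Squaring the decay bound gives $n^{-2\delta}(1+n|j-k|)^{-(4m-2\delta)}$ up to a constant, as
$\alpha M$ is bounded below. The exponent is then weakened to $\gamma<d$, so that the grid sum is a
clean power of $n$ whichever of $d$ and $4m-2\delta$ is larger. -/
lemma sum_sum_covariance_sq_le (hδ0 : 0 < δ) (hδ2 : δ < 2)
    {Ω : Set (EuclideanSpace ℝ (Fin d))} (hΩo : IsOpen Ω)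
    (hΩb : Bornology.IsBounded Ω) (hΩn : Ω.Nonempty) (hd : 0 < d) (hα : 0 < α)
    (hM : IsAnisotropy M) {m : ℕ} (hm : 1 ≤ m) {γ : ℝ} (hγ0 : 0 < γ)
    (hγd : γ < d) (hγm : γ ≤ 4 * m - 2 * δ) {h : EuclideanSpace ℝ (Fin d)} (hh : h ≠ 0) :
    ∃ C : ℝ, 0 < C ∧ ∀ᶠ n : ℕ in atTop, ∀ hn : n ≠ 0,
      ∑ j ∈ (grid_finite hΩb hn).toFinset, ∑ k ∈ (grid_finite hΩb hn).toFinset,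
        (incrementCov δ m ((α • Matrix.toEuclideanLin M) (j - k))
          ((α • Matrix.toEuclideanLin M) ((n : ℝ)⁻¹ • h))) ^ 2 ≤
      (C * (n : ℝ) ^ (-δ - γ / 2) * (grid Ω n).ncard) ^ 2 := by
  set A := α • Matrix.toEuclideanLin M with hA
  have hAinj : Function.Injective A := hM.injective hα
  have hAh : A h ≠ 0 := by
    rw [Ne, ← map_zero A]; exact fun h0 => hh (hAinj h0)
  have hAh' : 0 < ‖A h‖ := norm_pos_iff.2 hAh
  obtain ⟨K, hK0, hK⟩ := A.exists_antilipschitzWith (LinearMap.ker_eq_bot.2 hAinj)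
  have hlow : ∀ x, ‖x‖ ≤ K * ‖A x‖ := fun x => by
    simpa using hK.le_mul_dist x 0
  have hK0' : (0 : ℝ) < K := hK0
  set A' := LinearMap.toContinuousLinearMap A with hA'
  obtain ⟨R, hR0, hR⟩ := hΩb.exists_pos_norm_le
  obtain ⟨C₁, hC₁, hcov⟩ := exists_abs_incrementCov_le (E := EuclideanSpace ℝ (Fin d)) hδ0 hδ2 hm
    (‖A'‖ * (2 * R))
  obtain ⟨C₂, hC₂, hgrid⟩ := exists_sum_sum_grid_le hΩo hΩb hΩn hd hγ0 hγd
  set L : ℝ := 1 + K * ‖A h‖ with hL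
  have hL0 : 0 < L := by positivity
  set C₃ : ℝ := (C₁ * ‖A h‖ ^ δ) ^ 2 * L ^ γ * C₂ with hC₃
  have hC₃0 : 0 < C₃ := by positivity
  refine ⟨√C₃, Real.sqrt_pos.2 hC₃0, ?_⟩
  filter_upwards [hgrid] with n hgn hn
  have hn' : (0 : ℝ) < n := by positivity
  set G := (grid_finite hΩb hn).toFinset with hG
  have hterm : ∀ j ∈ G, ∀ k ∈ G,
      (incrementCov δ m (A (j - k)) (A ((n : ℝ)⁻¹ • h))) ^ 2 ≤
        (C₁ * ‖A h‖ ^ δ) ^ 2 * ((n : ℝ) ^ (-δ)) ^ 2 * L ^ γ * (1 + n * ‖j - k‖) ^ (-γ) := by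
    intro j hj k hk
    have hj' := hR j ((Set.Finite.mem_toFinset _).1 hj).1
    have hk' := hR k ((Set.Finite.mem_toFinset _).1 hk).1
    have hAx : ‖A (j - k)‖ ≤ ‖A'‖ * (2 * R) := by
      refine (A'.le_opNorm (j - k)).trans ?_
      have := norm_sub_le j k
      gcongr
      linarith
    have hAu : A ((n : ℝ)⁻¹ • h) = (n : ℝ)⁻¹ • A h := map_smul _ _ _
    have hAun : ‖(n : ℝ)⁻¹ • A h‖ = ‖A h‖ / n := by
      rw [norm_smul, norm_inv, Real.norm_natCast]; ring
    have h1 := hcov (A (j - k)) (A ((n : ℝ)⁻¹ • h)) (by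
      rw [hAu]; exact smul_ne_zero (by positivity) hAh) hAx
    rw [hAu] at h1 ⊢
    rw [hAun] at h1
    have hx : 1 + n * ‖j - k‖ ≤ L * (1 + ‖A (j - k)‖ / (‖A h‖ / n)) := by
      have h2 := hlow (j - k)
      have h3 : n * ‖j - k‖ ≤ K * ‖A h‖ * (‖A (j - k)‖ / (‖A h‖ / n)) := by
        have : K * ‖A h‖ * (‖A (j - k)‖ / (‖A h‖ / n)) = n * (K * ‖A (j - k)‖) := by field_simp
        rw [this]; gcongr
      have h4 : 0 ≤ ‖A (j - k)‖ / (‖A h‖ / n) := by positivity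
      rw [hL]
      nlinarith [mul_pos hK0' hAh']
    set s := 1 + ‖A (j - k)‖ / (‖A h‖ / n) with hs
    have hs1 : 1 ≤ s := by rw [hs]; linarith [show 0 ≤ ‖A (j - k)‖ / (‖A h‖ / n) by positivity]
    calc (incrementCov δ m (A (j - k)) ((n : ℝ)⁻¹ • A h)) ^ 2
        = |incrementCov δ m (A (j - k)) ((n : ℝ)⁻¹ • A h)| ^ 2 := (sq_abs _).symm
      _ ≤ (C₁ * (‖A h‖ / n) ^ δ * s ^ (δ - 2 * m)) ^ 2 := by gcongr
      _ = (C₁ * ‖A h‖ ^ δ) ^ 2 * ((n : ℝ) ^ (-δ)) ^ 2 * s ^ (-(4 * m - 2 * δ)) := by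
          have e : s ^ (-(4 * m - 2 * δ)) = (s ^ (δ - 2 * m)) ^ 2 := by
            rw [← Real.rpow_natCast, ← Real.rpow_mul (by linarith)]; congr 1; push_cast; ring
          rw [e, Real.div_rpow hAh'.le hn'.le, Real.rpow_neg hn'.le]; ring
      _ ≤ (C₁ * ‖A h‖ ^ δ) ^ 2 * ((n : ℝ) ^ (-δ)) ^ 2 * s ^ (-γ) := by gcongr
      _ ≤ (C₁ * ‖A h‖ ^ δ) ^ 2 * ((n : ℝ) ^ (-δ)) ^ 2 * (L ^ γ * (1 + n * ‖j - k‖) ^ (-γ)) := by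
          gcongr
          rw [Real.rpow_neg (by positivity), Real.rpow_neg (by positivity), ← div_eq_mul_inv,
            inv_eq_one_div, div_le_div_iff₀ (by positivity) (by positivity), one_mul,
            ← Real.mul_rpow hL0.le (by positivity)]
          gcongr
      _ = _ := by ring
  calc _ ≤ ∑ j ∈ G, ∑ k ∈ G, (C₁ * ‖A h‖ ^ δ) ^ 2 * ((n : ℝ) ^ (-δ)) ^ 2 * L ^ γ *
          (1 + n * ‖j - k‖) ^ (-γ) :=
        Finset.sum_le_sum fun j hj => Finset.sum_le_sum fun k hk => hterm j hj k hk
    _ = (C₁ * ‖A h‖ ^ δ) ^ 2 * ((n : ℝ) ^ (-δ)) ^ 2 * L ^ γ *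
          ∑ j ∈ G, ∑ k ∈ G, (1 + n * ‖j - k‖) ^ (-γ) := by simp_rw [← Finset.mul_sum]
    _ ≤ (C₁ * ‖A h‖ ^ δ) ^ 2 * ((n : ℝ) ^ (-δ)) ^ 2 * L ^ γ *
          (C₂ * (n : ℝ) ^ (-γ) * ((grid Ω n).ncard : ℝ) ^ 2) := by
        have := hgn hn
        gcongr
    _ = _ := by
        have e : ((n : ℝ) ^ (-δ - γ / 2)) ^ 2 = ((n : ℝ) ^ (-δ)) ^ 2 * (n : ℝ) ^ (-γ) := by
          rw [← Real.rpow_natCast, ← Real.rpow_natCast, ← Real.rpow_mul hn'.le,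
            ← Real.rpow_mul hn'.le, ← Real.rpow_add hn']
          congr 1; push_cast; ring
        rw [mul_pow _ ((grid Ω n).ncard : ℝ), mul_pow √C₃, Real.sq_sqrt hC₃0.le, e, hC₃]; ring

end Field

/-! ### Almost sure limits of $Q$, by concentration and Borel–Cantelli. -/

lemma summable_exp_neg_mul_rpow {c η : ℝ} (hc : 0 < c) (hη : 0 < η) :
    Summable fun n : ℕ => Real.exp (-c * (n : ℝ) ^ η) := by
  have h1 : (fun n : ℕ => Real.exp (-c * (n : ℝ) ^ η)) =O[atTop] fun n : ℕ => ((n : ℝ) ^ η) ^ (-2 / η) :=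
    ((isLittleO_exp_neg_mul_rpow_atTop hc (-2 / η)).isBigO.comp_tendsto
      ((tendsto_rpow_atTop hη).comp (tendsto_natCast_atTop_atTop (R := ℝ))))
  refine summable_of_isBigO_nat (g := fun n : ℕ => (n : ℝ) ^ (-2 : ℝ))
    (Real.summable_nat_rpow.2 (by norm_num)) (h1.congr_right fun n => ?_)
  rw [← Real.rpow_mul (Nat.cast_nonneg n)]
  congr 1
  field_simp

lemma ae_eventually_notMem_of_summable {S : Type*} [MeasurableSpace S] {P : Measure S}
    [IsFiniteMeasure P] {B : ℕ → Set S} {b : ℕ → ℝ} (hb0 : ∀ n, 0 ≤ b n) (hb : Summable b)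
    (h : ∀ᶠ n in atTop, P.real (B n) ≤ b n) : ∀ᵐ ω ∂P, ∀ᶠ n in atTop, ω ∉ B n := by
  obtain ⟨n₀, hn₀⟩ := eventually_atTop.1 h
  have hsum : ∑' n, P (B (n + n₀)) ≠ ⊤ := by
    refine ne_top_of_le_ne_top ((summable_nat_add_iff n₀).2 hb).tsum_ofReal_ne_top
      (ENNReal.tsum_le_tsum fun n => ?_)
    rw [ENNReal.le_ofReal_iff_toReal_le (by finiteness) (hb0 _)]
    exact hn₀ _ (Nat.le_add_left _ _)
  filter_upwards [ae_eventually_notMem hsum] with ω hω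
  obtain ⟨n₁, hn₁⟩ := eventually_atTop.1 hω
  refine eventually_atTop.2 ⟨n₁ + n₀, fun n hn => ?_⟩
  have := hn₁ (n - n₀) (by omega)
  rwa [Nat.sub_add_cancel (by omega)] at this

section Field

variable {d : ℕ} {S : Type*} [MeasurableSpace S] {P : Measure S}
  {Y : EuclideanSpace ℝ (Fin d) → S → ℝ} {δ σ α : ℝ} {M : Matrix (Fin d) (Fin d) ℝ}
  {Ω : Set (EuclideanSpace ℝ (Fin d))}

/-- The fluctuations of `Q` around its mean vanish almost surely at a polynomial rate. -/
lemma ae_tendsto_rpow_mul_Q_sub [IsProbabilityMeasure P] (hδ0 : 0 < δ) (hδ2 : δ < 2)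
    (hΩo : IsOpen Ω) (hΩb : Bornology.IsBounded Ω) (hΩn : Ω.Nonempty) (hd : 0 < d) (hσ : 0 < σ)
    (hα : 0 < α) (hM : IsAnisotropy M) (hY : IsExpField P Y δ σ α M) {m : ℕ} (hm : 1 ≤ m)
    {γ κ : ℝ} (hγ0 : 0 < γ) (hγd : γ < d) (hγm : γ ≤ 4 * m - 2 * δ) (hκ : κ < γ / 2)
    {h : EuclideanSpace ℝ (Fin d)} (hh : h ≠ 0) :
    ∀ᵐ ω ∂P, Tendsto (fun n : ℕ => (n : ℝ) ^ κ * (Q Ω δ m h n (fun t => Y t ω) -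
      σ ^ 2 * ((n : ℝ) ^ δ * incrementCov δ m 0
        ((n : ℝ)⁻¹ • (α • Matrix.toEuclideanLin M) h)))) atTop (𝓝 0) := by
  obtain ⟨C, hC, hfrob⟩ := sum_sum_covariance_sq_le hδ0 hδ2 hΩo hΩb hΩn hd hα hM hm hγ0 hγd hγm hh
  obtain ⟨c, hc, hcard⟩ := exists_le_ncard_grid hΩo hΩb hΩn
  -- Half of the available gap: deviations are tested at level $n^{-\eta}$, and the ratio of
  -- threshold to Frobenius scale is still of order $n^{\eta}$, which gives summable probabilities.
  set η := (γ / 2 - κ) / 2 with hη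
  have hη0 : 0 < η := by rw [hη]; linarith
  set A := α • Matrix.toEuclideanLin M with hA
  set X : ℕ → S → ℝ := fun n ω => (n : ℝ) ^ κ * (Q Ω δ m h n (fun t => Y t ω) -
      σ ^ 2 * ((n : ℝ) ^ δ * incrementCov δ m 0 ((n : ℝ)⁻¹ • A h))) with hX
  have hprob : ∀ᶠ n : ℕ in atTop, P.real {ω | (n : ℝ) ^ (-η) ≤ |X n ω|} ≤
      4 * Real.exp (-(8 * (σ ^ 2 * C))⁻¹ * (n : ℝ) ^ η) := by
    filter_upwards [hfrob, hcard, eventually_gt_atTop 0] with n hfr hN hn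
    have hn' : (0 : ℝ) < n := by exact_mod_cast hn
    have hN0 : (0 : ℝ) < (grid Ω n).ncard := lt_of_lt_of_le (by positivity) hN
    set N : ℝ := ((grid Ω n).ncard : ℝ) with hNdef
    set u := (n : ℝ)⁻¹ • h with hu
    set G := (grid_finite hΩb hn.ne').toFinset with hG
    have hcardG : (G.card : ℝ) = N := by
      rw [hNdef, Set.ncard_eq_toFinset_card _ (grid_finite hΩb hn.ne')]
    set Z : EuclideanSpace ℝ (Fin d) → S → ℝ := fun j ω => (fwdDiff u)^[m] (fun t => Y t ω) j with hZ
    have hlaw : HasGaussianLaw (fun ω => fun j : G => Z j ω) P :=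
      (isGaussianProcess_fwdDiff_iter hY.gaussian m u).hasGaussianLaw G
    have hcov : ∀ j k, cov[Z j, Z k; P] = σ ^ 2 * incrementCov δ m (A (j - k)) (A u) :=
      fun j k => covariance_fwdDiff_iter hY m u j k
    set F := σ ^ 2 * (C * (n : ℝ) ^ (-δ - γ / 2) * N) with hF
    have hF0 : 0 < F := by positivity
    have hfr' : ∑ j : G, ∑ k : G, cov[Z j, Z k; P] ^ 2 ≤ F ^ 2 := by
      have e1 : ∑ j : G, ∑ k : G, cov[Z j, Z k; P] ^ 2 =
          ∑ j ∈ G, ∑ k ∈ G, cov[Z j, Z k; P] ^ 2 := by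
        rw [← Finset.sum_coe_sort G]
        refine Finset.sum_congr rfl fun j _ => ?_
        rw [← Finset.sum_coe_sort G]
      rw [e1, hF, mul_pow]
      simp_rw [hcov, mul_pow (σ ^ 2), ← Finset.mul_sum]
      have := hfr hn.ne'
      gcongr
    have hconc := measure_abs_sum_sq_sub_ge_le (Z := fun (j : G) ω => Z j ω) hlaw
      (fun j => integral_fwdDiff_iter hY m u j) hF0 hfr' (N * (n : ℝ) ^ (-δ - κ - η))
    have hXeq : ∀ ω, |X n ω| =
        (n : ℝ) ^ κ * (n : ℝ) ^ δ * N⁻¹ * |∑ j : G, (Z j ω ^ 2 - cov[Z j, Z j; P])| := by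
      intro ω
      have e1 : ∑ j : G, (Z j ω ^ 2 - cov[Z j, Z j; P]) =
          ∑ j ∈ G, Z j ω ^ 2 - N * (σ ^ 2 * incrementCov δ m 0 (A u)) := by
        rw [Finset.sum_coe_sort G (fun j => Z j ω ^ 2 - cov[Z j, Z j; P])]
        simp_rw [hcov, sub_self, map_zero]
        rw [Finset.sum_sub_distrib, Finset.sum_const, nsmul_eq_mul, hcardG]
      have e2 : A u = (n : ℝ)⁻¹ • A h := map_smul _ _ _
      have e3 : X n ω = (n : ℝ) ^ κ * (n : ℝ) ^ δ * N⁻¹ *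
          ∑ j : G, (Z j ω ^ 2 - cov[Z j, Z j; P]) := by
        rw [e1, e2]
        simp only [hX, Q]
        rw [finsum_mem_eq_finite_toFinset_sum _ (grid_finite hΩb hn.ne'), ← Finset.mul_sum]
        simp only [hZ, ← hG, ← hNdef, ← hu]
        generalize incrementCov δ m 0 ((n : ℝ)⁻¹ • A h) = I
        field_simp
      rw [e3, abs_mul, abs_of_pos (by positivity)]
    have hsub : {ω | (n : ℝ) ^ (-η) ≤ |X n ω|} =
        {ω | N * (n : ℝ) ^ (-δ - κ - η) ≤ |∑ j : G, (Z j ω ^ 2 - cov[Z j, Z j; P])|} := by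
      ext ω
      simp only [Set.mem_ofPred_eq]
      rw [hXeq]
      have e4 : (n : ℝ) ^ (-η) = (n : ℝ) ^ κ * (n : ℝ) ^ δ * N⁻¹ * (N * (n : ℝ) ^ (-δ - κ - η)) := by
        have : (n : ℝ) ^ κ * (n : ℝ) ^ δ * (n : ℝ) ^ (-δ - κ - η) = (n : ℝ) ^ (-η) := by
          rw [← Real.rpow_add hn', ← Real.rpow_add hn']; congr 1; ring
        rw [← this]; field_simp
      rw [e4]
      exact mul_le_mul_iff_right₀ (by positivity)
    rw [hsub]
    refine hconc.trans (le_of_eq ?_)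
    congr 2
    have e5 : (n : ℝ) ^ (-δ - κ - η) = (n : ℝ) ^ (-δ - γ / 2) * (n : ℝ) ^ η := by
      rw [← Real.rpow_add hn']; congr 1; rw [hη]; ring
    rw [e5, hF]
    field_simp
  have hsummable := (summable_exp_neg_mul_rpow (c := (8 * (σ ^ 2 * C))⁻¹) (by positivity)
    hη0).mul_left 4
  filter_upwards [ae_eventually_notMem_of_summable (fun n => by positivity) hsummable hprob]
    with ω hω
  have hlim : Tendsto (fun n : ℕ => (n : ℝ) ^ (-η)) atTop (𝓝 0) :=
    (tendsto_rpow_neg_atTop hη0).comp tendsto_natCast_atTop_atTop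
  refine squeeze_zero_norm' ?_ hlim
  filter_upwards [hω] with n hn
  simp only [not_le] at hn
  exact hn.le

lemma IsAnisotropy.apply_ne_zero (hM : IsAnisotropy M) (hα : 0 < α)
    {h : EuclideanSpace ℝ (Fin d)} (hh : h ≠ 0) : (α • Matrix.toEuclideanLin M) h ≠ 0 := by
  rw [Ne, ← map_zero (α • Matrix.toEuclideanLin M)]
  exact fun h0 => hh (hM.injective hα h0)

lemma tendsto_variance {E : Type*} [NormedAddCommGroup E] [InnerProductSpace ℝ E] {δ : ℝ}
    (hδ0 : 0 < δ) {m : ℕ} (hm : 1 ≤ m) {b : E} (hb : b ≠ 0) :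
    Tendsto (fun n : ℕ => (n : ℝ) ^ δ * incrementCov δ m 0 ((n : ℝ)⁻¹ • b)) atTop
      (𝓝 (-(‖b‖ ^ δ * D m δ))) := by
  have h1 := (tendsto_variance_expansion hδ0 hm hb).mul
    ((tendsto_rpow_neg_atTop hδ0).comp (tendsto_natCast_atTop_atTop (R := ℝ)))
  have h2 := h1.sub_const (‖b‖ ^ δ * D m δ)
  rw [mul_zero, zero_sub] at h2
  refine h2.congr' ?_
  filter_upwards [eventually_gt_atTop 0] with n hn
  have hn' : (0 : ℝ) < n := by exact_mod_cast hn
  simp only [Function.comp_apply]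
  rw [Real.rpow_neg hn'.le]
  field_simp
  ring

/-- Almost sure limit of `Q`. -/
lemma ae_tendsto_Q [IsProbabilityMeasure P] (hδ0 : 0 < δ) (hδ2 : δ < 2)
    (hΩo : IsOpen Ω) (hΩb : Bornology.IsBounded Ω) (hΩn : Ω.Nonempty) (hd : 0 < d) (hσ : 0 < σ)
    (hα : 0 < α) (hM : IsAnisotropy M) (hY : IsExpField P Y δ σ α M) {m : ℕ} (hm : 1 ≤ m)
    {h : EuclideanSpace ℝ (Fin d)} (hh : h ≠ 0) :
    ∀ᵐ ω ∂P, Tendsto (fun n : ℕ => Q Ω δ m h n (fun t => Y t ω)) atTop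
      (𝓝 (-(σ ^ 2 * ‖(α • Matrix.toEuclideanLin M) h‖ ^ δ * D m δ))) := by
  have hd' : (0 : ℝ) < d := by exact_mod_cast hd
  have hm' : (1 : ℝ) ≤ m := by exact_mod_cast hm
  have hmin : 0 < min (d : ℝ) (4 * m - 2 * δ) := lt_min hd' (by linarith)
  have h1 := min_le_left (d : ℝ) (4 * m - 2 * δ)
  have h2 := min_le_right (d : ℝ) (4 * m - 2 * δ)
  -- Any $\gamma$ strictly between $0$ and $\min(d,4m-2\delta)$ would do here, since no rate is
  -- required.
  filter_upwards [ae_tendsto_rpow_mul_Q_sub (γ := min (d : ℝ) (4 * m - 2 * δ) / 2) (κ := 0) hδ0 hδ2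
    hΩo hΩb hΩn hd hσ hα hM hY hm (by linarith) (by linarith) (by linarith) (by linarith) hh]
    with ω hω
  have h3 := hω.add ((tendsto_variance hδ0 hm (hM.apply_ne_zero hα hh)).const_mul (σ ^ 2))
  rw [zero_add, mul_neg, ← mul_assoc] at h3
  refine h3.congr fun n => ?_
  rw [Real.rpow_zero]; ring

/-- Almost sure second order expansion of `Q`. -/
lemma ae_tendsto_rpow_mul_Q_add [IsProbabilityMeasure P] (hδ0 : 0 < δ) (hδ2 : δ < 2)
    (hΩo : IsOpen Ω) (hΩb : Bornology.IsBounded Ω) (hΩn : Ω.Nonempty) (hd : 0 < d) (hσ : 0 < σ)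
    (hα : 0 < α) (hM : IsAnisotropy M) (hY : IsExpField P Y δ σ α M) (hδd : 2 * δ < d) {m : ℕ}
    (hm : 1 ≤ m) (hmδ : δ < m) {h : EuclideanSpace ℝ (Fin d)} (hh : h ≠ 0) :
    ∀ᵐ ω ∂P, Tendsto (fun n : ℕ => (n : ℝ) ^ δ * (Q Ω δ m h n (fun t => Y t ω) +
        σ ^ 2 * ‖(α • Matrix.toEuclideanLin M) h‖ ^ δ * D m δ)) atTop
      (𝓝 (σ ^ 2 * (‖(α • Matrix.toEuclideanLin M) h‖ ^ (2 * δ) * D m (2 * δ) / 2))) := by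
  have hmin : 2 * δ < min (d : ℝ) (4 * m - 2 * δ) := lt_min hδd (by linarith)
  have h1 := min_le_left (d : ℝ) (4 * m - 2 * δ)
  have h2 := min_le_right (d : ℝ) (4 * m - 2 * δ)
  -- The rate $\kappa=\delta$ needs $\gamma>2\delta$. The midpoint of $2\delta$ and
  -- $\min(d,4m-2\delta)$ is admissible because $2\delta<d$ and $\delta<m$.
  filter_upwards [ae_tendsto_rpow_mul_Q_sub (γ := (2 * δ + min (d : ℝ) (4 * m - 2 * δ)) / 2) (κ := δ)
    hδ0 hδ2 hΩo hΩb hΩn hd hσ hα hM hY hm (by linarith) (by linarith) (by linarith) (by linarith) hh]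
    with ω hω
  have h3 := hω.add
    ((tendsto_variance_expansion hδ0 hm (hM.apply_ne_zero hα hh)).const_mul (σ ^ 2))
  rw [zero_add] at h3
  refine h3.congr fun n => ?_
  ring

end Field

/-! ### Continuity of the triangular factorisation. -/

lemma tendsto_matrix_inv {k : ℕ} {A : ℕ → Matrix (Fin k) (Fin k) ℝ} {B : Matrix (Fin k) (Fin k) ℝ}
    (hA : Tendsto A atTop (𝓝 B)) (hB : B.det ≠ 0) :
    Tendsto (fun n => (A n)⁻¹) atTop (𝓝 B⁻¹) := by
  simp only [Matrix.inv_def, Ring.inverse_eq_inv']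
  have h1 : Tendsto (fun n => (A n).det) atTop (𝓝 B.det) :=
    ((continuous_id.matrix_det).tendsto B).comp hA
  have h2 : Tendsto (fun n => (A n).adjugate) atTop (𝓝 B.adjugate) :=
    ((continuous_id.matrix_adjugate).tendsto B).comp hA
  exact (h1.inv₀ hB).smul h2

/-- The triangular factor depends continuously on the Gram matrix and recovers an upper triangular
matrix with positive diagonal. -/
lemma tendsto_triangularFactor : ∀ {k : ℕ} {T : Matrix (Fin k) (Fin k) ℝ}
    {G : ℕ → Matrix (Fin k) (Fin k) ℝ}, (∀ i j, j < i → T i j = 0) → (∀ i, 0 < T i i) →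
    Tendsto G atTop (𝓝 (T.transpose * T)) →
    Tendsto (fun n => triangularFactor k (G n)) atTop (𝓝 T) := by
  intro k
  induction k with
  | zero =>
    intro T G _ _ _
    rw [Subsingleton.elim T 0]
    exact tendsto_const_nhds
  | succ k ih =>
    intro T G hup hpos hG
    set T' : Matrix (Fin k) (Fin k) ℝ := T.submatrix Fin.castSucc Fin.castSucc with hT'
    set w : Fin k → ℝ := fun i => T i.castSucc (Fin.last k) with hw
    have hlast : ∀ i : Fin k, T (Fin.last k) i.castSucc = 0 := fun i =>
      hup _ _ (Fin.castSucc_lt_last i)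
    have hentry : ∀ i j, Tendsto (fun n => G n i j) atTop (𝓝 ((T.transpose * T) i j)) := fun i j =>
      tendsto_pi_nhds.1 (tendsto_pi_nhds.1 hG i) j
    have hR : Tendsto (fun n => triangularFactor k ((G n).submatrix Fin.castSucc Fin.castSucc)) atTop
        (𝓝 T') := by
      refine ih (fun i j hij => hup _ _ (Fin.castSucc_lt_castSucc_iff.2 hij)) (fun i => hpos _) ?_
      refine tendsto_pi_nhds.2 fun i => tendsto_pi_nhds.2 fun j => ?_
      have h1 := hentry i.castSucc j.castSucc
      -- The last row of $T$ vanishes off the diagonal, so the leading block of the Gram matrix is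
      -- the Gram matrix of the leading block.
      have e : (T.transpose * T) i.castSucc j.castSucc = (T'.transpose * T') i j := by
        simp [Matrix.mul_apply, Fin.sum_univ_castSucc, hlast, hT']
      rw [e] at h1
      exact h1
    have hdet : T'.transpose.det ≠ 0 := by
      have htri : T'.IsUpperTriangular := fun i j hij =>
        hup _ _ (Fin.castSucc_lt_castSucc_iff.2 hij)
      rw [Matrix.det_transpose, Matrix.det_of_isUpperTriangular htri]
      exact (Finset.prod_pos fun i _ => hpos _).ne'
    have hv : Tendsto (fun n => Matrix.mulVec
        (triangularFactor k ((G n).submatrix Fin.castSucc Fin.castSucc)).transpose⁻¹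
          fun i => G n i.castSucc (Fin.last k)) atTop (𝓝 w) := by
      have h1 := tendsto_matrix_inv (((continuous_id.matrix_transpose).tendsto T').comp hR) hdet
      have h2 : Tendsto (fun n => fun i : Fin k => G n i.castSucc (Fin.last k)) atTop
          (𝓝 (T'.transpose.mulVec w)) := by
        refine tendsto_pi_nhds.2 fun i => ?_
        have h3 := hentry i.castSucc (Fin.last k)
        have e : (T.transpose * T) i.castSucc (Fin.last k) = T'.transpose.mulVec w i := by
          simp [Matrix.mul_apply, Matrix.mulVec, dotProduct, Fin.sum_univ_castSucc, hlast, hT', hw]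
        rwa [e] at h3
      have h4 : Continuous fun p : Matrix (Fin k) (Fin k) ℝ × (Fin k → ℝ) => p.1.mulVec p.2 :=
        continuous_fst.matrix_mulVec continuous_snd
      have h5 := (h4.tendsto (T'.transpose⁻¹, T'.transpose.mulVec w)).comp (h1.prodMk_nhds h2)
      simp only [Matrix.mulVec_mulVec] at h5
      rw [Matrix.nonsing_inv_mul _ (isUnit_iff_ne_zero.2 hdet), Matrix.one_mulVec] at h5
      exact h5
    have hr : Tendsto (fun n => Real.sqrt (G n (Fin.last k) (Fin.last k) -
        ∑ i, (Matrix.mulVec (triangularFactor k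
          ((G n).submatrix Fin.castSucc Fin.castSucc)).transpose⁻¹
            fun i => G n i.castSucc (Fin.last k)) i ^ 2)) atTop
        (𝓝 (T (Fin.last k) (Fin.last k))) := by
      have h1 := ((hentry (Fin.last k) (Fin.last k)).sub (tendsto_finsetSum Finset.univ
        fun i _ => (tendsto_pi_nhds.1 hv i).pow 2)).sqrt
      -- In the limit the square root recovers the last diagonal entry itself, since that entry is
      -- positive.
      have e : (T.transpose * T) (Fin.last k) (Fin.last k) - ∑ i, w i ^ 2 =
          T (Fin.last k) (Fin.last k) ^ 2 := by
        simp [Matrix.mul_apply, Fin.sum_univ_castSucc, hw, sq]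
      rw [e, Real.sqrt_sq (hpos _).le] at h1
      exact h1
    refine tendsto_pi_nhds.2 fun i => tendsto_pi_nhds.2 fun j => ?_
    induction i using Fin.lastCases with
    | last =>
      induction j using Fin.lastCases with
      | last => simpa [triangularFactor] using hr
      | cast j => simp [triangularFactor, hlast]
    | cast i =>
      induction j using Fin.lastCases with
      | last => simpa [triangularFactor] using tendsto_pi_nhds.1 hv i
      | cast j => simpa [triangularFactor, hT'] using tendsto_pi_nhds.1 (tendsto_pi_nhds.1 hR i) j

/-! ### Consistency of the estimators. -/

section Estimators

variable {d : ℕ} {S : Type*} [MeasurableSpace S] {P : Measure S}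
  {Y : EuclideanSpace ℝ (Fin d) → S → ℝ} {δ σ α : ℝ} {M : Matrix (Fin d) (Fin d) ℝ}
  {Ω : Set (EuclideanSpace ℝ (Fin d))}

/-- Almost sure limit of the estimator of `|T h|²`. -/
lemma ae_tendsto_normSqEst [IsProbabilityMeasure P] (hδ0 : 0 < δ) (hδ2 : δ < 2)
    (hΩo : IsOpen Ω) (hΩb : Bornology.IsBounded Ω) (hΩn : Ω.Nonempty) (hd : 0 < d) (hσ : 0 < σ)
    (hα : 0 < α) (hM : IsAnisotropy M) (hY : IsExpField P Y δ σ α M) {p : ℕ} (hp : 1 ≤ p)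
    {h : EuclideanSpace ℝ (Fin d)} (hh : h ≠ 0) :
    ∀ᵐ ω ∂P, Tendsto (fun n : ℕ => normSqEst Ω δ p h n (fun t => Y t ω)) atTop
      (𝓝 (‖Matrix.toEuclideanLin ((σ ^ (2 / δ) * α) • M) h‖ ^ 2)) := by
  have hD := D_neg hp hδ0 hδ2
  have hA := norm_pos_iff.2 (hM.apply_ne_zero hα hh)
  filter_upwards [ae_tendsto_Q hδ0 hδ2 hΩo hΩb hΩn hd hσ hα hM hY hp hh] with ω hω
  have h1 : Tendsto (fun n : ℕ => firstEst Ω δ p h n (fun t => Y t ω)) atTop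
      (𝓝 (σ ^ 2 * ‖(α • Matrix.toEuclideanLin M) h‖ ^ δ)) := by
    have h2 := hω.neg.div_const (D p δ)
    rw [neg_neg, mul_div_cancel_right₀ _ hD.ne] at h2
    exact h2
  have h3 := h1.rpow_const (p := 2 / δ) (Or.inl (by positivity))
  have e : (σ ^ 2 * ‖(α • Matrix.toEuclideanLin M) h‖ ^ δ) ^ (2 / δ) =
      ‖Matrix.toEuclideanLin ((σ ^ (2 / δ) * α) • M) h‖ ^ 2 := by
    have e1 : Matrix.toEuclideanLin ((σ ^ (2 / δ) * α) • M) h =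
        σ ^ (2 / δ) • (α • Matrix.toEuclideanLin M) h := by
      rw [map_smul, mul_smul]; rfl
    rw [e1, norm_smul, Real.norm_of_nonneg (by positivity), mul_pow,
      Real.mul_rpow (by positivity) (by positivity), ← Real.rpow_mul hA.le,
      mul_div_cancel₀ _ hδ0.ne', Real.rpow_two, ← Real.rpow_natCast σ 2, ← Real.rpow_natCast (σ ^ (2 / δ)) 2,
      ← Real.rpow_mul hσ.le, ← Real.rpow_mul hσ.le, mul_comm (2 / δ)]
  rw [e] at h3
  exact h3

lemma toEuclideanLin_single (T : Matrix (Fin d) (Fin d) ℝ) (i l : Fin d) :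
    Matrix.toEuclideanLin T (EuclideanSpace.single i 1) l = T l i := by
  simp [Matrix.toLpLin_apply]

lemma transpose_mul_self_apply_self (T : Matrix (Fin d) (Fin d) ℝ) (i : Fin d) :
    (T.transpose * T) i i = ‖Matrix.toEuclideanLin T (EuclideanSpace.single i 1)‖ ^ 2 := by
  rw [EuclideanSpace.real_norm_sq_eq, Matrix.mul_apply]
  refine Finset.sum_congr rfl fun l _ => ?_
  rw [toEuclideanLin_single, Matrix.transpose_apply, sq]

lemma transpose_mul_self_apply (T : Matrix (Fin d) (Fin d) ℝ) (i j : Fin d) :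
    (T.transpose * T) i j =
      (‖Matrix.toEuclideanLin T (EuclideanSpace.single i 1)‖ ^ 2 +
        ‖Matrix.toEuclideanLin T (EuclideanSpace.single j 1)‖ ^ 2 -
        ‖Matrix.toEuclideanLin T (EuclideanSpace.single j 1 - EuclideanSpace.single i 1)‖ ^ 2) / 2 := by
  simp only [EuclideanSpace.real_norm_sq_eq, map_sub, PiLp.sub_apply, toEuclideanLin_single,
    Matrix.mul_apply, Matrix.transpose_apply]
  rw [← Finset.sum_add_distrib, ← Finset.sum_sub_distrib, Finset.sum_div]
  exact Finset.sum_congr rfl fun l _ => by ring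

/-- Almost sure limit of the estimator of `T`. -/
lemma ae_tendsto_scaledEst [IsProbabilityMeasure P] (hδ0 : 0 < δ) (hδ2 : δ < 2)
    (hΩo : IsOpen Ω) (hΩb : Bornology.IsBounded Ω) (hΩn : Ω.Nonempty) (hd : 0 < d) (hσ : 0 < σ)
    (hα : 0 < α) (hM : IsAnisotropy M) (hY : IsExpField P Y δ σ α M) {p : ℕ} (hp : 1 ≤ p) :
    ∀ᵐ ω ∂P, Tendsto (fun n : ℕ => scaledEst Ω δ p n (fun t => Y t ω)) atTop
      (𝓝 ((σ ^ (2 / δ) * α) • M)) := by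
  have hρ : 0 < σ ^ (2 / δ) * α := by positivity
  have hdiag : ∀ᵐ ω ∂P, ∀ i : Fin d, Tendsto (fun n : ℕ =>
      normSqEst Ω δ p (EuclideanSpace.single i 1) n (fun t => Y t ω)) atTop
        (𝓝 (‖Matrix.toEuclideanLin ((σ ^ (2 / δ) * α) • M) (EuclideanSpace.single i 1)‖ ^ 2)) :=
    ae_all_iff.2 fun i => ae_tendsto_normSqEst hδ0 hδ2 hΩo hΩb hΩn hd hσ hα hM hY hp (by simp)
  have hoff : ∀ᵐ ω ∂P, ∀ i j : Fin d, i ≠ j → Tendsto (fun n : ℕ =>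
      normSqEst Ω δ p (EuclideanSpace.single j 1 - EuclideanSpace.single i 1) n (fun t => Y t ω)) atTop
        (𝓝 (‖Matrix.toEuclideanLin ((σ ^ (2 / δ) * α) • M)
          (EuclideanSpace.single j 1 - EuclideanSpace.single i 1)‖ ^ 2)) := by
    refine ae_all_iff.2 fun i => ae_all_iff.2 fun j => ?_
    by_cases hij : i = j
    · exact ae_of_all _ fun ω h => absurd hij h
    · have hne : (EuclideanSpace.single j 1 - EuclideanSpace.single i 1 :
          EuclideanSpace ℝ (Fin d)) ≠ 0 := by
        intro h0
        have := congrArg (fun v : EuclideanSpace ℝ (Fin d) => v j) h0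
        simp [Ne.symm hij] at this
      filter_upwards [ae_tendsto_normSqEst hδ0 hδ2 hΩo hΩb hΩn hd hσ hα hM hY hp hne] with ω hω _
      exact hω
  filter_upwards [hdiag, hoff] with ω h1 h2
  refine tendsto_triangularFactor (fun i j hij => by simp [hM.upper i j hij])
    (fun i => by simpa using mul_pos hρ (hM.diag_pos i)) ?_
  refine tendsto_pi_nhds.2 fun i => tendsto_pi_nhds.2 fun j => ?_
  by_cases hij : i = j
  · subst hij
    rw [transpose_mul_self_apply_self]
    simpa [gramEst] using h1 i
  · rw [transpose_mul_self_apply]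
    simpa [gramEst, hij] using (((h1 i).add (h1 j)).sub (h2 i j hij)).div_const 2

/-- Strong consistency of the estimators of `σ² α^δ` and `M`. -/
lemma ae_tendsto_microergodicEst_anisotropyEst [IsProbabilityMeasure P] (hδ0 : 0 < δ) (hδ2 : δ < 2)
    (hΩo : IsOpen Ω) (hΩb : Bornology.IsBounded Ω) (hΩn : Ω.Nonempty) (hd : 0 < d) (hσ : 0 < σ)
    (hα : 0 < α) (hM : IsAnisotropy M) (hY : IsExpField P Y δ σ α M) {p : ℕ} (hp : 1 ≤ p) :
    ∀ᵐ ω ∂P,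
      Tendsto (fun n : ℕ => microergodicEst Ω δ p n (fun t => Y t ω)) atTop
        (𝓝 (σ ^ 2 * α ^ δ)) ∧
      Tendsto (fun n : ℕ => anisotropyEst Ω δ p n (fun t => Y t ω)) atTop (𝓝 M) := by
  have hd' : (0 : ℝ) < d := by exact_mod_cast hd
  set ρ := σ ^ (2 / δ) * α with hρdef
  have hρ : 0 < ρ := by positivity
  filter_upwards [ae_tendsto_scaledEst hδ0 hδ2 hΩo hΩb hΩn hd hσ hα hM hY hp] with ω hω
  -- As $\det M=1$, the determinant of $T=\rho M$ is $\rho^d$. It determines $\rho$, and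
  -- $\rho^\delta=\sigma^2\alpha^\delta$.
  have hdet : Tendsto (fun n : ℕ => (scaledEst Ω δ p n (fun t => Y t ω)).det) atTop (𝓝 (ρ ^ d)) := by
    have := ((continuous_id.matrix_det).tendsto (ρ • M)).comp hω
    simpa [Function.comp_def, Matrix.det_smul, hM.det_eq_one] using this
  have hρd : ρ ^ d ≠ 0 := by positivity
  constructor
  · have h1 := hdet.rpow_const (p := δ / d) (Or.inl hρd)
    have e : (ρ ^ d) ^ (δ / (d : ℝ)) = σ ^ 2 * α ^ δ := by
      rw [← Real.rpow_natCast, ← Real.rpow_mul hρ.le, mul_div_cancel₀ _ hd'.ne', hρdef,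
        Real.mul_rpow (by positivity) hα.le, ← Real.rpow_mul hσ.le, div_mul_cancel₀ _ hδ0.ne',
        Real.rpow_two]
    rw [e] at h1
    exact h1
  · have h1 := (hdet.rpow_const (p := -(1 / (d : ℝ))) (Or.inl hρd)).smul hω
    have e : (ρ ^ d) ^ (-(1 / (d : ℝ))) • ρ • M = M := by
      rw [← Real.rpow_natCast, ← Real.rpow_mul hρ.le, mul_neg, mul_one_div_cancel hd'.ne',
        Real.rpow_neg_one, inv_smul_smul₀ hρ.ne']
    rw [e] at h1
    exact h1

/-- Almost sure limit of the contrast estimator. -/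
lemma ae_tendsto_secondEst [IsProbabilityMeasure P] (hδ0 : 0 < δ) (hδ2 : δ < 2)
    (hΩo : IsOpen Ω) (hΩb : Bornology.IsBounded Ω) (hΩn : Ω.Nonempty) (hd : 0 < d) (hσ : 0 < σ)
    (hα : 0 < α) (hM : IsAnisotropy M) (hY : IsExpField P Y δ σ α M) (hδd : 2 * δ < d) {p q : ℕ}
    (hp : 1 ≤ p) (hpδ : δ < p) (hpq : p < q) (hc : contrast p q δ ≠ 0)
    {h : EuclideanSpace ℝ (Fin d)} (hh : h ≠ 0) :
    ∀ᵐ ω ∂P, Tendsto (fun n : ℕ => secondEst Ω δ p q h n (fun t => Y t ω)) atTop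
      (𝓝 (σ ^ 2 * ‖(α • Matrix.toEuclideanLin M) h‖ ^ (2 * δ))) := by
  have hq : 1 ≤ q := hp.trans hpq.le
  have hqδ : δ < q := hpδ.trans (by exact_mod_cast hpq)
  have hDq := (D_neg hq hδ0 hδ2).ne
  filter_upwards [ae_tendsto_rpow_mul_Q_add hδ0 hδ2 hΩo hΩb hΩn hd hσ hα hM hY hδd hp hpδ hh,
    ae_tendsto_rpow_mul_Q_add hδ0 hδ2 hΩo hΩb hΩn hd hσ hα hM hY hδd hq hqδ hh] with ω h1 h2
  -- The weight $D_{p,\delta}/D_{q,\delta}$ cancels the leading terms of the two expansions, leaving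
  -- the contrast times $\tfrac12\sigma^2|\alpha Mh|^{2\delta}$.
  have h3 := ((h1.sub (h2.const_mul (D p δ / D q δ))).const_mul 2).div_const (contrast p q δ)
  have e : 2 * (σ ^ 2 * (‖(α • Matrix.toEuclideanLin M) h‖ ^ (2 * δ) * D p (2 * δ) / 2) -
      D p δ / D q δ * (σ ^ 2 * (‖(α • Matrix.toEuclideanLin M) h‖ ^ (2 * δ) * D q (2 * δ) / 2))) /
      contrast p q δ = σ ^ 2 * ‖(α • Matrix.toEuclideanLin M) h‖ ^ (2 * δ) := by
    rw [div_eq_iff hc, contrast]; ring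
  rw [e] at h3
  refine h3.congr fun n => ?_
  rw [secondEst]
  congr 1
  field_simp
  ring

/-- Almost sure limit of the estimator of `σ² α^{2δ}`. -/
lemma ae_tendsto_secondCoeffEst [IsProbabilityMeasure P] (hδ0 : 0 < δ) (hδ2 : δ < 2)
    (hΩo : IsOpen Ω) (hΩb : Bornology.IsBounded Ω) (hΩn : Ω.Nonempty) (hd : 0 < d) (hσ : 0 < σ)
    (hα : 0 < α) (hM : IsAnisotropy M) (hY : IsExpField P Y δ σ α M) (hδd : 2 * δ < d) {p q : ℕ}
    (hp : 1 ≤ p) (hpδ : δ < p) (hpq : p < q) (hc : contrast p q δ ≠ 0)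
    {h : EuclideanSpace ℝ (Fin d)} (hh : h ≠ 0) :
    ∀ᵐ ω ∂P, Tendsto (fun n : ℕ => secondCoeffEst Ω δ p q h n (fun t => Y t ω)) atTop
      (𝓝 (σ ^ 2 * α ^ (2 * δ))) := by
  have hMh : Matrix.toEuclideanLin M h ≠ 0 := by
    simpa using hM.apply_ne_zero one_pos hh
  have hMh' := norm_pos_iff.2 hMh
  filter_upwards [ae_tendsto_secondEst hδ0 hδ2 hΩo hΩb hΩn hd hσ hα hM hY hδd hp hpδ hpq hc hh,
    ae_tendsto_microergodicEst_anisotropyEst hδ0 hδ2 hΩo hΩb hΩn hd hσ hα hM hY hp]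
    with ω h1 h2
  have hcont : Continuous fun N : Matrix (Fin d) (Fin d) ℝ => ‖Matrix.toEuclideanLin N h‖ := by
    simp only [Matrix.toLpLin_apply]
    exact ((PiLp.continuous_toLp 2 _).comp (continuous_id.matrix_mulVec continuous_const)).norm
  have h3 := ((hcont.tendsto M).comp h2.2).rpow_const (p := 2 * δ) (Or.inl hMh'.ne')
  have h4 := h1.div h3 (by positivity)
  have e : σ ^ 2 * ‖(α • Matrix.toEuclideanLin M) h‖ ^ (2 * δ) /
      ‖Matrix.toEuclideanLin M h‖ ^ (2 * δ) = σ ^ 2 * α ^ (2 * δ) := by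
    rw [LinearMap.smul_apply, norm_smul, Real.norm_of_nonneg hα.le,
      Real.mul_rpow hα.le hMh'.le]
    field_simp
  rw [e] at h4
  exact h4

/-- Strong consistency of the estimators of `σ` and `α`. -/
lemma ae_tendsto_sigmaEst_alphaEst [IsProbabilityMeasure P] (hδ0 : 0 < δ) (hδ2 : δ < 2)
    (hΩo : IsOpen Ω) (hΩb : Bornology.IsBounded Ω) (hΩn : Ω.Nonempty) (hd : 0 < d) (hσ : 0 < σ)
    (hα : 0 < α) (hM : IsAnisotropy M) (hY : IsExpField P Y δ σ α M) (hδd : 2 * δ < d) {p q : ℕ}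
    (hp : 1 ≤ p) (hpδ : δ < p) (hpq : p < q) (hc : contrast p q δ ≠ 0)
    {h : EuclideanSpace ℝ (Fin d)} (hh : h ≠ 0) :
    ∀ᵐ ω ∂P,
      Tendsto (fun n : ℕ => sigmaEst Ω δ p q h n (fun t => Y t ω)) atTop (𝓝 σ) ∧
      Tendsto (fun n : ℕ => alphaEst Ω δ p q h n (fun t => Y t ω)) atTop (𝓝 α) := by
  filter_upwards [ae_tendsto_secondCoeffEst hδ0 hδ2 hΩo hΩb hΩn hd hσ hα hM hY hδd hp hpδ hpq hc hh,
    ae_tendsto_microergodicEst_anisotropyEst hδ0 hδ2 hΩo hΩb hΩn hd hσ hα hM hY hp]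
    with ω h1 h2
  have hα2 : α ^ (2 * δ) = (α ^ δ) ^ 2 := by
    rw [mul_comm, Real.rpow_mul hα.le, Real.rpow_two]
  have hαδ : 0 < α ^ δ := by positivity
  constructor
  · have h3 := ((h2.1.pow 2).div h1 (by positivity)).sqrt
    have e : √((σ ^ 2 * α ^ δ) ^ 2 / (σ ^ 2 * α ^ (2 * δ))) = σ := by
      rw [hα2]
      have : (σ ^ 2 * α ^ δ) ^ 2 / (σ ^ 2 * (α ^ δ) ^ 2) = σ ^ 2 := by field_simp
      rw [this, Real.sqrt_sq hσ.le]
    rw [e] at h3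
    exact h3
  · have h3 := (h1.div h2.1 (by positivity)).rpow_const (p := 1 / δ) (Or.inl (by positivity))
    have e : (σ ^ 2 * α ^ (2 * δ) / (σ ^ 2 * α ^ δ)) ^ (1 / δ) = α := by
      rw [hα2]
      have : σ ^ 2 * (α ^ δ) ^ 2 / (σ ^ 2 * α ^ δ) = α ^ δ := by field_simp
      rw [this, ← Real.rpow_mul hα.le, mul_one_div_cancel hδ0.ne', Real.rpow_one]
    rw [e] at h3
    exact h3

end Estimators

end IncrementEstimation

end

open IncrementEstimation in
theorem theorem5 (d : ℕ) (hd : 0 < d) (δ : ℝ) (hδ0 : 0 < δ) (hδ2 : δ < 2)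
    (Ω : Set (EuclideanSpace ℝ (Fin d))) (hΩo : IsOpen Ω) (hΩb : Bornology.IsBounded Ω)
    (hΩn : Ω.Nonempty) :
    (∀ p : ℕ, 1 ≤ p → D p δ ≠ 0 ∧
      ∀ (S : Type*) [MeasurableSpace S] (P : Measure S) [IsProbabilityMeasure P]
        (Y : EuclideanSpace ℝ (Fin d) → S → ℝ) (σ α : ℝ) (M : Matrix (Fin d) (Fin d) ℝ),
        0 < σ → 0 < α → IsAnisotropy M → IsExpField P Y δ σ α M →
        ∀ᵐ ω ∂P,
          Tendsto (fun n : ℕ => microergodicEst Ω δ p n (fun t => Y t ω)) atTop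
            (𝓝 (σ ^ 2 * α ^ δ)) ∧
          Tendsto (fun n : ℕ => anisotropyEst Ω δ p n (fun t => Y t ω)) atTop (𝓝 M)) ∧
    (2 * δ < d → δ ≠ 1 → ∀ p : ℕ, 3 * δ / 2 < p → ∃ q : ℕ, p < q ∧ contrast p q δ ≠ 0 ∧
      ∀ (S : Type*) [MeasurableSpace S] (P : Measure S) [IsProbabilityMeasure P]
        (Y : EuclideanSpace ℝ (Fin d) → S → ℝ) (σ α : ℝ) (M : Matrix (Fin d) (Fin d) ℝ),
        0 < σ → 0 < α → IsAnisotropy M → IsExpField P Y δ σ α M →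
        ∀ h : EuclideanSpace ℝ (Fin d), h ≠ 0 →
          ∀ᵐ ω ∂P,
            Tendsto (fun n : ℕ => sigmaEst Ω δ p q h n (fun t => Y t ω)) atTop (𝓝 σ) ∧
            Tendsto (fun n : ℕ => alphaEst Ω δ p q h n (fun t => Y t ω)) atTop (𝓝 α)) := by
  refine ⟨fun p hp => ⟨(D_neg hp hδ0 hδ2).ne, ?_⟩, fun hδd hδ1 p hp => ?_⟩
  · intro S _ P _ Y σ α M hσ hα hM hY
    exact ae_tendsto_microergodicEst_anisotropyEst hδ0 hδ2 hΩo hΩb hΩn hd hσ hα hM hY hp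
  · have hp1 : 1 ≤ p := by
      have : (0 : ℝ) < p := lt_trans (by positivity) hp
      exact_mod_cast this
    have hpδ : δ < p := by linarith
    obtain ⟨q, hpq, hc⟩ := exists_contrast_ne_zero hδ0 hδ2 hδ1 hp1
    refine ⟨q, hpq, hc, ?_⟩
    intro S _ P _ Y σ α M hσ hα hM hY h hh
    exact ae_tendsto_sigmaEst_alphaEst hδ0 hδ2 hΩo hΩb hΩn hd hσ hα hM hY hδd hp1 hpδ hpq hc hh
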